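/- **Setting.** Let $\mathcal X\subset\mathbb R^d$ be measurable, let $(\mathbf X,Y)$ be a random pair with values in $\mathcal X\times\mathbb R$, and fix a regular conditional law of $Y$ given $\mathbf X$, with distribution function $F(y|\mathbf x)=\mathbb P(Y\le y\mid \mathbf X=\mathbf x)$. Let $(\mathbf X^j,Y^j)_{j\ge1}$ be i.i.d. copies of $(\mathbf X,Y)$ and $\mathcal D_n=(\mathbf X^j,Y^j)_{j=1,\dots,n}$. Let $\Theta_1,\Theta_2,\dots$ be i.i.d. random elements, independent of $(\mathbf X^j,Y^j)_{j\ge 1}$. For every $n$, $\Theta_\ell$ contains $n$ indices drawn uniformly with replacement from $\{1,\dots,n\}$ (these select the bootstrap sample $\mathcal D_n^\star(\Theta_\ell)$) and, independently of them, for every possible tree node an independent uniform subset of $\{1,\dots,d\}$ with $\mathit{max\_features}\in\{1,\dots,d\}$ elements. The joint law of these data for different $n$ is arbitrary. The $\ell$-th tree for sample size $n$ is a CART regression tree grown on $\mathcal D_n^\star(\Theta_\ell)$ only. Its root cell is $\mathcal X$. Each cell that is cut is cut perpendicularly to a coordinate axis (into $\{x_i<z\}$ and $\{x_i\ge z\}$)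 so as to minimize the sum over the two children of the squared errors of the bootstrap responses about their mean in the child, among the cuts along the coordinates preselected at the node that leave at least $\mathit{min\_samples\_leaf}\in\{1,\dots,n\}$ bootstrap observations in each child. Ties may be resolved and the growth stopped by any measurable rule that is a function of the bootstrap sample and the preselected coordinates, and the parameters $\mathit{max\_features}$ and $\mathit{min\_samples\_leaf}$ may depend on $n$. Let $A_n(\mathbf x;\Theta_\ell,\mathcal D_n)\subset\mathcal X$ be the leaf cell containing $\mathbf x$, and let $N_n^b(\mathbf x;\Theta_\ell,\mathcal D_n)$ and $N_n^o(\mathbf x;\Theta_\ell,\mathcal D_n)$ be the numbers of elements of $\mathcal D_n^\star(\Theta_\ell)$ (with multiplicity) and of $\mathcal D_n$ that fall into it. With $k=k_n\ge1$ trees, put $$F^o_{k,n}(y|\mathbf x)=\sum_{j=1}^n\Big(\frac1k\sum_{\ell=1}^k\frac{\mathbf 1\{\mathbf X^j\in A_n(\mathbf x;\Theta_\ell,\mathcal D_n)\}}{N_n^o(\mathbf x;\Theta_\ell,\mathcal D_n)}\Big)\mathbf 1\{Y^j\le y\}.$$ **Theorem.** Write $f(n)=\Omega(g(n))$ if there are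 $c>0$ and $n_0$ with $|f(n)|\ge c|g(n)|$ for all $n\ge n_0$, and $\mathrm{CV}(N)=\sigma_N/\mathbb E[N]$. Assume: 1. For all $\ell$, all $\mathbf x\in\mathcal X$ and all $y\in\mathbb R$, $\ \sup_{\mathbf z\in A_n(\mathbf x;\Theta_\ell,\mathcal D_n)}|F(y|\mathbf z)-F(y|\mathbf x)|\to0$ almost surely as $n\to\infty$. 2. $k_n=\mathcal O(n^\alpha)$ for some $\alpha>0$, and at least one of the following holds, for every $\ell$ (equivalently, for one $\ell$): (a) for some $\beta>1$ and all $\mathbf x\in\mathcal X$, almost surely $N_n^b(\mathbf x;\Theta_\ell,\mathcal D_n)=\Omega(\sqrt n(\ln n)^\beta)$; (b) for some $\beta>1$ and $\gamma>1$ and all $\mathbf x\in\mathcal X$, $\ \mathbb E[N_n^b(\mathbf x;\Theta_\ell,\mathcal D_n)]=\Omega(\sqrt n(\ln n)^\beta)$ and $\mathrm{CV}(N_n^b(\mathbf x;\Theta_\ell,\mathcal D_n))=\mathcal O\big(1/(\sqrt n(\ln n)^{\gamma/2})\big)$. 3. For every $\mathbf x\in\mathcal X$, $y\mapsto F(y|\mathbf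 x)$ is continuous and strictly increasing. Then for every $\mathbf x\in\mathcal X$, $$\sup_{y\in\mathbb R}\big|F^o_{k_n,n}(y|\mathbf x)-F(y|\mathbf x)\big|\longrightarrow0\quad\text{almost surely as } n\to\infty.$$ -/

import Mathlib

open MeasureTheory ProbabilityTheory Filter Topology

noncomputable section

/-- Binary trees of cuts perpendicular to the axes: `node i z l r` cuts along coordinate `i` at
position `z`; points with `x i < z` go to `l`, points with `z ≤ x i` go to `r`. -/
inductive SplitTree (d : ℕ) : Type
  | leaf : SplitTree d
  | node (i : Fin d) (z : ℝ) (l r : SplitTree d) : SplitTree d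

/-- The lower child of the cell `A` for the cut `(i, z)`. -/
def lowerCell {d : ℕ} (A : Set (Fin d → ℝ)) (i : Fin d) (z : ℝ) : Set (Fin d → ℝ) :=
  A ∩ {u | u i < z}

/-- The upper child of the cell `A` for the cut `(i, z)`. -/
def upperCell {d : ℕ} (A : Set (Fin d → ℝ)) (i : Fin d) (z : ℝ) : Set (Fin d → ℝ) :=
  A ∩ {u | z ≤ u i}

open Classical in
/-- The cell of the leaf reached by `x` when the root cell of the tree is `A`. -/
def leafCell {d : ℕ} : SplitTree d → Set (Fin d → ℝ) → (Fin d → ℝ) → Set (Fin d → ℝ)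
  | .leaf, A, _ => A
  | .node i z l r, A, x =>
      if x i < z then leafCell l (lowerCell A i z) x else leafCell r (upperCell A i z) x

open Classical in
/-- Positions of the observations of the sample `S` that fall into `A`. -/
def obsIn {d n : ℕ} (S : Fin n → (Fin d → ℝ) × ℝ) (A : Set (Fin d → ℝ)) : Finset (Fin n) :=
  Finset.univ.filter fun j => (S j).1 ∈ A

/-- Number of observations of the sample `S` (with multiplicity) that fall into `A`. -/
def countIn {d n : ℕ} (S : Fin n → (Fin d → ℝ) × ℝ) (A : Set (Fin d → ℝ)) : ℕ :=
  (obsIn S A).card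

/-- Mean response of the observations of `S` in `A`. -/
def meanIn {d n : ℕ} (S : Fin n → (Fin d → ℝ) × ℝ) (A : Set (Fin d → ℝ)) : ℝ :=
  (∑ j ∈ obsIn S A, (S j).2) / (countIn S A : ℝ)

/-- Squared error in `A` of the prediction by the mean response in `A`. -/
def squaredError {d n : ℕ} (S : Fin n → (Fin d → ℝ) × ℝ) (A : Set (Fin d → ℝ)) : ℝ :=
  ∑ j ∈ obsIn S A, ((S j).2 - meanIn S A) ^ 2

/-- The CART criterion of the cut `(i, z)` of `A`, to be minimized: the prediction squared error
in the two child nodes. -/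
def splitCost {d n : ℕ} (S : Fin n → (Fin d → ℝ) × ℝ) (A : Set (Fin d → ℝ))
    (i : Fin d) (z : ℝ) : ℝ :=
  squaredError S (lowerCell A i z) + squaredError S (upperCell A i z)

/-- The cut is along a preselected direction and leaves at least `m` observations of the sample
in each child node. -/
def IsAdmissibleSplit {d n : ℕ} (m : ℕ) (V : Finset (Fin d)) (S : Fin n → (Fin d → ℝ) × ℝ)
    (A : Set (Fin d → ℝ)) (i : Fin d) (z : ℝ) : Prop :=
  i ∈ V ∧ m ≤ countIn S (lowerCell A i z) ∧ m ≤ countIn S (upperCell A i z)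

/-- The cut is best for the CART criterion among the admissible cuts. -/
def IsCARTSplit {d n : ℕ} (m : ℕ) (V : Finset (Fin d)) (S : Fin n → (Fin d → ℝ) × ℝ)
    (A : Set (Fin d → ℝ)) (i : Fin d) (z : ℝ) : Prop :=
  IsAdmissibleSplit m V S A i z ∧
    ∀ (i' : Fin d) (z' : ℝ), IsAdmissibleSplit m V S A i' z' →
      splitCost S A i z ≤ splitCost S A i' z'

/-- `IsCARTTree m V S T A v`: the tree `T`, whose root is the node with address `v` and cell `A`,
is a CART regression tree on the sample `S`. `V v` is the set of coordinates preselected at the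
node with address `v`, the address recording the turns taken from the root (`false`: lower).
Ties in the criterion may be resolved in any way, and any stopping rule is allowed. -/
def IsCARTTree {d n : ℕ} (m : ℕ) (V : List Bool → Finset (Fin d))
    (S : Fin n → (Fin d → ℝ) × ℝ) : SplitTree d → Set (Fin d → ℝ) → List Bool → Prop
  | .leaf, _, _ => True
  | .node i z l r, A, v =>
      IsCARTSplit m (V v) S A i z ∧
        IsCARTTree m V S l (lowerCell A i z) (v ++ [false]) ∧
        IsCARTTree m V S r (upperCell A i z) (v ++ [true])

/-- A tree growing procedure: for each sample size `n`, a tree as a function of the preselected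
coordinates and of the (bootstrap) sample. -/
abbrev GrowingRule (d : ℕ) : Type :=
  (n : ℕ) → (List Bool → Finset (Fin d)) → (Fin n → (Fin d → ℝ) × ℝ) → SplitTree d

/-- The procedure grows CART trees on `𝒳` with minimal leaf size `minLeaf n`, and membership of
a point in the leaf of `x` is an event. -/
structure IsCARTRule {d : ℕ} (𝒳 : Set (Fin d → ℝ)) (minLeaf : ℕ → ℕ)
    (grow : GrowingRule d) : Prop where
  isCART : ∀ (n : ℕ) (V : List Bool → Finset (Fin d)) (S : Fin n → (Fin d → ℝ) × ℝ),
    IsCARTTree (minLeaf n) V S (grow n V S) 𝒳 []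
  measurable_cell : ∀ (n : ℕ), ∀ x ∈ 𝒳,
    MeasurableSet {p : (List Bool → Finset (Fin d)) × (Fin n → (Fin d → ℝ) × ℝ) × (Fin d → ℝ) |
      p.2.2 ∈ leafCell (grow n p.1 p.2.1) 𝒳 x}

/-- Values of the variable that randomizes one tree. For each sample size `n`: the indices of the
`n` bootstrap draws, and the coordinates preselected at each node address. -/
abbrev TreeSeed (d : ℕ) : Type :=
  (n : ℕ) → (Fin n → Fin n) × (List Bool → Finset (Fin d))

/-- `Θ 0, Θ 1, …` are i.i.d. For each sample size `n`, the bootstrap draws are uniform with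
replacement, the node addresses receive independent uniform sets of `maxFeatures n` coordinates,
independent of the draws. Nothing is asked about the joint law for different `n`. -/
structure IsForestSeed {Ω : Type*} [MeasurableSpace Ω] (μ : Measure Ω) {d : ℕ}
    (maxFeatures : ℕ → ℕ) (Θ : ℕ → Ω → TreeSeed d) : Prop where
  measurable : ∀ l, Measurable (Θ l)
  indep : iIndepFun Θ μ
  identDistrib : ∀ l, IdentDistrib (Θ l) (Θ 0) μ μ
  draws_uniform : ∀ (l n : ℕ) (f : Fin n → Fin n),
    μ {ω | (Θ l ω n).1 = f} = ((n : ENNReal) ^ n)⁻¹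
  features_uniform : ∀ (l n : ℕ) (v : List Bool) (V : Finset (Fin d)),
    V.card = maxFeatures n → μ {ω | (Θ l ω n).2 v = V} = (d.choose (maxFeatures n) : ENNReal)⁻¹
  features_indep : ∀ l n : ℕ, iIndepFun (fun (v : List Bool) ω => (Θ l ω n).2 v) μ
  draws_indep_features : ∀ l n : ℕ,
    IndepFun (fun ω => (Θ l ω n).1) (fun ω => (Θ l ω n).2) μ

/-- The training sample of size `n`: the first `n` observations. -/
def trainingSample {Ω : Type*} {d : ℕ} (D : ℕ → Ω → (Fin d → ℝ) × ℝ) (n : ℕ) (ω : Ω) :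
    Fin n → (Fin d → ℝ) × ℝ :=
  fun j => D j ω

/-- The bootstrap sample of size `n` of the tree randomized by `θ`. -/
def bootstrapSample {Ω : Type*} {d : ℕ} (D : ℕ → Ω → (Fin d → ℝ) × ℝ) (θ : Ω → TreeSeed d)
    (n : ℕ) (ω : Ω) : Fin n → (Fin d → ℝ) × ℝ :=
  fun i => trainingSample D n ω ((θ ω n).1 i)

/-- `A_n(x; θ, D_n)`: the cell containing `x` of the tree grown on the bootstrap sample. -/
def treeCell {Ω : Type*} {d : ℕ} (𝒳 : Set (Fin d → ℝ)) (grow : GrowingRule d)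
    (D : ℕ → Ω → (Fin d → ℝ) × ℝ) (θ : Ω → TreeSeed d) (x : Fin d → ℝ) (n : ℕ) (ω : Ω) :
    Set (Fin d → ℝ) :=
  leafCell (grow n (θ ω n).2 (bootstrapSample D θ n ω)) 𝒳 x

/-- `N_n^b(x; θ, D_n)`: number of elements of the bootstrap sample in the cell of `x`. -/
def bootstrapCount {Ω : Type*} {d : ℕ} (𝒳 : Set (Fin d → ℝ)) (grow : GrowingRule d)
    (D : ℕ → Ω → (Fin d → ℝ) × ℝ) (θ : Ω → TreeSeed d) (x : Fin d → ℝ) (n : ℕ) (ω : Ω) : ℕ :=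
  countIn (bootstrapSample D θ n ω) (treeCell 𝒳 grow D θ x n ω)

/-- `N_n^o(x; θ, D_n)`: number of elements of the original sample in the cell of `x`. -/
def originalCount {Ω : Type*} {d : ℕ} (𝒳 : Set (Fin d → ℝ)) (grow : GrowingRule d)
    (D : ℕ → Ω → (Fin d → ℝ) × ℝ) (θ : Ω → TreeSeed d) (x : Fin d → ℝ) (n : ℕ) (ω : Ω) : ℕ :=
  countIn (trainingSample D n ω) (treeCell 𝒳 grow D θ x n ω)

/-- The weight `w_{n,j}^o(x; Θ_1, …, Θ_k, D_n)` of the `j`-th observation. -/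
def originalWeight {Ω : Type*} {d : ℕ} (𝒳 : Set (Fin d → ℝ)) (grow : GrowingRule d)
    (D : ℕ → Ω → (Fin d → ℝ) × ℝ) (Θ : ℕ → Ω → TreeSeed d) (k : ℕ) (x : Fin d → ℝ)
    (n : ℕ) (ω : Ω) (j : Fin n) : ℝ :=
  (1 / (k : ℝ)) * ∑ l ∈ Finset.range k,
    (treeCell 𝒳 grow D (Θ l) x n ω).indicator (fun _ => (1 : ℝ)) (D j ω).1 /
      (originalCount 𝒳 grow D (Θ l) x n ω : ℝ)

/-- The estimator `F_{k,n}^o(y | x; Θ_1, …, Θ_k, D_n)`. -/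
def originalEstimator {Ω : Type*} {d : ℕ} (𝒳 : Set (Fin d → ℝ)) (grow : GrowingRule d)
    (D : ℕ → Ω → (Fin d → ℝ) × ℝ) (Θ : ℕ → Ω → TreeSeed d) (k : ℕ) (x : Fin d → ℝ)
    (n : ℕ) (ω : Ω) (y : ℝ) : ℝ :=
  ∑ j : Fin n, originalWeight 𝒳 grow D Θ k x n ω j *
    (Set.Iic y).indicator (fun _ => (1 : ℝ)) (D j ω).2

/-- The conditional distribution function `F(y | x)` for the regular conditional law `κ`. -/
def condDistFun {d : ℕ} (κ : Kernel (Fin d → ℝ) ℝ) (x : Fin d → ℝ) (y : ℝ) : ℝ :=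
  (κ x).real (Set.Iic y)

/-- `f = Ω(g)`. -/
def IsBigOmega (f g : ℕ → ℝ) : Prop :=
  ∃ c > 0, ∃ n₀ > 0, ∀ n ≥ n₀, c * |g n| ≤ |f n|

/-- Coefficient of variation: standard deviation over mean. -/
def coeffVariation {Ω : Type*} [MeasurableSpace Ω] (μ : Measure Ω) (N : Ω → ℝ) : ℝ :=
  √(variance N μ) / ∫ ω, N ω ∂μ

/-- First hypothesis: the variation of the conditional distribution function within the cell of
any point goes to `0` almost surely, for every tree. -/
def CellVariationVanishes {Ω : Type*} [MeasurableSpace Ω] (μ : Measure Ω) {d : ℕ}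
    (𝒳 : Set (Fin d → ℝ)) (κ : Kernel (Fin d → ℝ) ℝ) (grow : GrowingRule d)
    (D : ℕ → Ω → (Fin d → ℝ) × ℝ) (Θ : ℕ → Ω → TreeSeed d) : Prop :=
  ∀ l : ℕ, ∀ x ∈ 𝒳, ∀ y : ℝ, ∀ᵐ ω ∂μ,
    Tendsto (fun n : ℕ => ⨆ z : treeCell 𝒳 grow D (Θ l) x n ω,
      |condDistFun κ (z : Fin d → ℝ) y - condDistFun κ x y|) atTop (𝓝 0)

/-- Leaves contain many bootstrap observations, almost surely. -/
def LeafSizeAlmostSure {Ω : Type*} [MeasurableSpace Ω] (μ : Measure Ω) {d : ℕ}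
    (𝒳 : Set (Fin d → ℝ)) (grow : GrowingRule d)
    (D : ℕ → Ω → (Fin d → ℝ) × ℝ) (Θ : ℕ → Ω → TreeSeed d) : Prop :=
  ∃ β : ℝ, 1 < β ∧ ∀ l : ℕ, ∀ x ∈ 𝒳, ∀ᵐ ω ∂μ,
    IsBigOmega (fun n => (bootstrapCount 𝒳 grow D (Θ l) x n ω : ℝ))
      (fun n => √(n : ℝ) * Real.log n ^ β)

/-- Leaves contain many bootstrap observations on average, with a small coefficient of
variation. -/
def LeafSizeMoments {Ω : Type*} [MeasurableSpace Ω] (μ : Measure Ω) {d : ℕ}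
    (𝒳 : Set (Fin d → ℝ)) (grow : GrowingRule d)
    (D : ℕ → Ω → (Fin d → ℝ) × ℝ) (Θ : ℕ → Ω → TreeSeed d) : Prop :=
  (∃ β : ℝ, 1 < β ∧ ∀ l : ℕ, ∀ x ∈ 𝒳,
    IsBigOmega (fun n => ∫ ω, (bootstrapCount 𝒳 grow D (Θ l) x n ω : ℝ) ∂μ)
      (fun n => √(n : ℝ) * Real.log n ^ β)) ∧
  (∃ γ : ℝ, 1 < γ ∧ ∀ l : ℕ, ∀ x ∈ 𝒳,
    (fun n : ℕ => coeffVariation μ fun ω => (bootstrapCount 𝒳 grow D (Θ l) x n ω : ℝ))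
      =O[atTop] fun n : ℕ => 1 / (√(n : ℝ) * Real.log n ^ (γ / 2)))

end

/-!
Fix a point `x` of `𝒳`. The estimators and `F(· | x)` are distribution functions (the former
possibly of mass less than one), and `F(· | x)` is continuous, so by Pólya's theorem
(`ae_tendsto_iSup_abs_sub_of_monotone`) it suffices to prove almost sure convergence at each fixed
`y`.

The estimator is the average over the trees of the estimates `cellEstimate`, each of which uses only
the observations in the leaf of `x`, and the error of each lies in `[0, 1]`. If it tends to `0`
almost surely for every single tree, then the average tends to `0` almost surely for any sequence
`k n` of numbers of trees: given the data, the error sequences of the trees are i.i.d., the strong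
law of large numbers applies to their suprema over `n ≥ m`, and the means of these suprema tend to
`0` as `m → ∞` by dominated convergence (`ae_tendsto_average_zero`,
`ae_tendsto_average_zero_of_indepFun`). So no bound uniform over the trees is needed.

For a single tree, the error is at most the variation of `F(y | ·)` in the leaf, which vanishes
by assumption, plus `|∑ (𝟙{Y ≤ y} - F(y | X))|` over the observations in the leaf, divided by their
number (`abs_cellEstimate_sub_le`). The leaf depends on the data, but it is the trace of a box, and
boxes pick out at most `n ^ (2 * d)` nonempty parts of the sample, each being cut out by the closed
box spanned by `2 * d` observations (`IsBoxTrace.exists_corners`). Hoeffding's inequality, a union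
bound and the Borel–Cantelli lemma bound the sum by `√n log n + 2 * d` for all boxes at once
(`ae_eventually_abs_sum_indicator_mul_le`). In the same way, given the data, the numbers of
bootstrap and of original observations in a box differ by at most `√n log n`
(`ae_eventually_abs_countIn_bootstrap_sub_le`). The leaf contains at least `c √n (log n) ^ β`
bootstrap observations with `β > 1`, under the moment assumption by Chebyshev's inequality
(`ae_exists_le_bootstrapCount`), so both quantities are negligible with respect to its size.
-/

/-! ### Concentration inequalities -/

/-- For independent `U` and `V`, a bound on the probability that `(u, V)` lies in `S`, uniform in
`u`, also holds for `(U, V)`. -/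
theorem measure_indepFun_pair_le {Ω α β : Type*} [MeasurableSpace Ω] [MeasurableSpace α]
    [MeasurableSpace β] {μ : Measure Ω} [IsProbabilityMeasure μ] {U : Ω → α} {V : Ω → β}
    (hU : Measurable U) (hV : Measurable V) (h : IndepFun U V μ) {S : Set (α × β)}
    (hS : MeasurableSet S) {ε : ENNReal} (hε : ∀ u, μ {ω | (u, V ω) ∈ S} ≤ ε) :
    μ {ω | (U ω, V ω) ∈ S} ≤ ε := by
  have hmap := (indepFun_iff_map_prod_eq_prod_map_map hU.aemeasurable hV.aemeasurable).1 h
  have : IsProbabilityMeasure (μ.map U) := Measure.isProbabilityMeasure_map hU.aemeasurable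
  have : IsProbabilityMeasure (μ.map V) := Measure.isProbabilityMeasure_map hV.aemeasurable
  calc μ {ω | (U ω, V ω) ∈ S} = μ.map (fun ω => (U ω, V ω)) S :=
        (Measure.map_apply (hU.prodMk hV) hS).symm
    _ = ∫⁻ u, μ.map V (Prod.mk u ⁻¹' S) ∂(μ.map U) := by
        rw [hmap, Measure.prod_apply hS]
    _ ≤ ∫⁻ _, ε ∂(μ.map U) := by
        refine lintegral_mono fun u => ?_
        rw [Measure.map_apply hV (measurable_prodMk_left hS)]
        exact hε u
    _ = ε := by simp

/-- Two-sided **Hoeffding inequality** for at most `n` centred variables with values in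
`[-1, 1]`. -/
theorem measure_lt_abs_sum_le {Ω ι : Type*} [MeasurableSpace Ω] {μ : Measure Ω}
    [IsProbabilityMeasure μ] {X : ι → Ω → ℝ} (hindep : iIndepFun X μ)
    (hX : ∀ i, Measurable (X i)) (hb : ∀ i ω, |X i ω| ≤ 1) (h0 : ∀ i, ∫ ω, X i ω ∂μ = 0)
    {s : Finset ι} {n : ℕ} (hs : s.card ≤ n) {t : ℝ} (ht : 0 ≤ t) :
    μ {ω | t < |∑ i ∈ s, X i ω|} ≤ 2 * ENNReal.ofReal (Real.exp (-t ^ 2 / (2 * n))) := by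
  rcases s.eq_empty_or_nonempty with rfl | hne
  · simp [not_lt.2 ht]
  have key : ∀ Y : ι → Ω → ℝ, iIndepFun Y μ → (∀ i, Measurable (Y i)) → (∀ i ω, |Y i ω| ≤ 1) →
      (∀ i, ∫ ω, Y i ω ∂μ = 0) →
      μ {ω | t ≤ ∑ i ∈ s, Y i ω} ≤ ENNReal.ofReal (Real.exp (-t ^ 2 / (2 * n))) := by
    intro Y hYi hY hYb hY0
    have hsub : ∀ i ∈ s, HasSubgaussianMGF (Y i) 1 μ := fun i _ => by
      have := hasSubgaussianMGF_of_mem_Icc_of_integral_eq_zero (a := -1) (b := 1)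
        (hY i).aemeasurable (ae_of_all μ fun ω => abs_le.1 (hYb i ω)) (hY0 i)
      convert this using 1
      ext
      norm_num
    have h := HasSubgaussianMGF.measure_sum_ge_le_of_iIndepFun hYi hsub ht
    rw [← ofReal_measureReal]
    refine ENNReal.ofReal_le_ofReal (h.trans (Real.exp_le_exp.2 ?_))
    have h1 : (0 : ℝ) < s.card := by exact_mod_cast hne.card_pos
    have h2 : (s.card : ℝ) ≤ n := by exact_mod_cast hs
    simp only [Finset.sum_const, nsmul_eq_mul, mul_one, NNReal.coe_natCast, neg_div,
      neg_le_neg_iff]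
    gcongr
  have hneg : iIndepFun (fun i ω => -X i ω) μ :=
    hindep.comp (fun _ => Neg.neg) fun _ => measurable_neg
  calc μ {ω | t < |∑ i ∈ s, X i ω|}
      ≤ μ ({ω | t ≤ ∑ i ∈ s, X i ω} ∪ {ω | t ≤ ∑ i ∈ s, -X i ω}) := by
        refine measure_mono fun ω (hω : t < _) => ?_
        rcases lt_abs.1 hω with h | h
        · exact Or.inl h.le
        · refine Or.inr ?_
          simpa using h.le
    _ ≤ _ := measure_union_le _ _
    _ ≤ _ := by
        rw [two_mul]
        exact add_le_add (key X hindep hX hb h0)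
          (key _ hneg (fun i => (hX i).neg) (by simpa using hb)
            (fun i => by rw [integral_neg, h0, neg_zero]))

/-- The threshold `√n log n` dominates the fluctuations of `n ^ p` sums of `n` terms: the union
bound over polynomially many Hoeffding tails is summable. -/
theorem tsum_mul_exp_log_sq_ne_top (p : ℕ) :
    ∑' n : ℕ, (n : ENNReal) ^ p *
      (2 * ENNReal.ofReal (Real.exp (-(√(n : ℝ) * Real.log n) ^ 2 / (2 * n)))) ≠ ⊤ := by
  have hsum : Summable fun n : ℕ =>
      (n : ℝ) ^ p * (2 * Real.exp (-(√(n : ℝ) * Real.log n) ^ 2 / (2 * n))) := by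
    have hlog : ∀ᶠ n : ℕ in atTop, (2 * (p + 2) : ℝ) ≤ Real.log n :=
      (Real.tendsto_log_atTop.comp tendsto_natCast_atTop_atTop).eventually_ge_atTop _
    refine summable_of_isBigO_nat (Real.summable_one_div_nat_pow.2 one_lt_two)
      (Asymptotics.IsBigO.of_bound 2 ?_)
    filter_upwards [hlog, eventually_gt_atTop 0] with n hn hpos
    have hn0 : (0 : ℝ) < n := by exact_mod_cast hpos
    have hexp : Real.exp (-(√(n : ℝ) * Real.log n) ^ 2 / (2 * n)) ≤ ((n : ℝ) ^ (p + 2))⁻¹ := by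
      have h1 : ((n : ℝ) ^ (p + 2))⁻¹ = Real.exp (-(p + 2) * Real.log n) := by
        rw [neg_mul, Real.exp_neg, mul_comm, Real.exp_mul, Real.exp_log hn0]
        norm_cast
      have h2 : -(√(n : ℝ) * Real.log n) ^ 2 / (2 * n) = -(Real.log n ^ 2 / 2) := by
        rw [mul_pow, Real.sq_sqrt hn0.le]
        field_simp
      rw [h1, h2, Real.exp_le_exp]
      have : (0 : ℝ) ≤ p := Nat.cast_nonneg p
      nlinarith
    rw [Real.norm_of_nonneg (by positivity), Real.norm_of_nonneg (by positivity)]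
    calc (n : ℝ) ^ p * (2 * Real.exp (-(√(n : ℝ) * Real.log n) ^ 2 / (2 * n)))
        ≤ (n : ℝ) ^ p * (2 * ((n : ℝ) ^ (p + 2))⁻¹) := by gcongr
      _ = 2 * (1 / (n : ℝ) ^ 2) := by
        rw [pow_add]
        field_simp
  convert hsum.tsum_ofReal_ne_top using 3 with n
  rw [ENNReal.ofReal_mul (by positivity), ENNReal.ofReal_mul zero_le_two,
    ENNReal.ofReal_pow (Nat.cast_nonneg n)]
  simp

/-! ### Averages of conditionally i.i.d. variables -/

/-- If `g n (Θ l) → 0` almost surely for each of the i.i.d. variables `Θ l`, where `0 ≤ g n ≤ 1`,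
then the averages of `g n (Θ l)` over `l < k n` tend to `0` too, no matter how `k n` varies with
`n`. For `k n` large this is the strong law of large numbers for the suprema over
`n ≥ m`, whose mean is small for `m` large. -/
theorem ae_tendsto_average_zero {Ω α : Type*} [MeasurableSpace Ω] [MeasurableSpace α]
    {μ : Measure Ω} [IsProbabilityMeasure μ] {Θ : ℕ → Ω → α} (hΘ : ∀ l, Measurable (Θ l))
    (hindep : iIndepFun Θ μ) (hident : ∀ l, IdentDistrib (Θ l) (Θ 0) μ μ)
    {g : ℕ → α → ℝ} (hg : ∀ n, Measurable (g n)) (hg0 : ∀ n a, 0 ≤ g n a)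
    (hg1 : ∀ n a, g n a ≤ 1) (k : ℕ → ℕ)
    (hlim : ∀ᵐ ω ∂μ, ∀ l, Tendsto (fun n => g n (Θ l ω)) atTop (𝓝 0)) :
    ∀ᵐ ω ∂μ, Tendsto (fun n => (∑ l ∈ Finset.range (k n), g n (Θ l ω)) / (k n : ℝ))
      atTop (𝓝 0) := by
  -- `G m` is the supremum of the `g n` over `n ≥ m`
  set G : ℕ → α → ℝ := fun m a => ⨆ i, g (m + i) a with hG
  have hbdd : ∀ m a, BddAbove (Set.range fun i => g (m + i) a) := fun m a =>
    ⟨1, by rintro _ ⟨i, rfl⟩; exact hg1 _ _⟩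
  have hGm : ∀ m, Measurable (G m) := fun m => Measurable.iSup fun i => hg (m + i)
  have hG0 : ∀ m a, 0 ≤ G m a := fun m a => Real.iSup_nonneg fun i => hg0 _ _
  have hG1 : ∀ m a, G m a ≤ 1 := fun m a => ciSup_le fun i => hg1 _ _
  have hgG : ∀ {m n} a, m ≤ n → g n a ≤ G m a := fun {m n} a hmn => by
    obtain ⟨i, rfl⟩ := Nat.exists_eq_add_of_le hmn
    exact le_ciSup (hbdd m a) i
  have hslln : ∀ᵐ ω ∂μ, ∀ m, Tendsto (fun K : ℕ => (∑ l ∈ Finset.range K, G m (Θ l ω)) / K) atTop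
      (𝓝 (∫ ω, G m (Θ 0 ω) ∂μ)) := by
    refine ae_all_iff.2 fun m => strong_law_ae_real (fun l ω => G m (Θ l ω)) ?_ ?_ ?_
    · exact Integrable.of_mem_Icc 0 1 ((hGm m).comp (hΘ 0)).aemeasurable
        (ae_of_all _ fun ω => ⟨hG0 _ _, hG1 _ _⟩)
    · exact fun i j hij => (hindep.indepFun hij).comp (hGm m) (hGm m)
    · exact fun l => (hident l).comp (hGm m)
  have hmean : Tendsto (fun m => ∫ ω, G m (Θ 0 ω) ∂μ) atTop (𝓝 0) := by
    have := tendsto_integral_of_dominated_convergence (μ := μ) (F := fun m ω => G m (Θ 0 ω))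
      (f := fun _ => (0 : ℝ)) (fun _ => 1)
      (fun m => ((hGm m).comp (hΘ 0)).aestronglyMeasurable) (integrable_const _)
      (fun m => ae_of_all _ fun ω => by
        rw [Real.norm_of_nonneg (hG0 _ _)]
        exact hG1 _ _) ?_
    · simpa using this
    filter_upwards [hlim] with ω hω
    refine Metric.tendsto_atTop.2 fun ε hε => ?_
    obtain ⟨N, hN⟩ := Metric.tendsto_atTop.1 (hω 0) (ε / 2) (by positivity)
    refine ⟨N, fun m hm => ?_⟩
    rw [Real.dist_eq, sub_zero, abs_of_nonneg (hG0 _ _)]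
    refine lt_of_le_of_lt (ciSup_le fun i => ?_) (half_lt_self hε)
    have := hN (m + i) (by omega)
    rw [Real.dist_eq, sub_zero] at this
    exact (le_abs_self _).trans this.le
  filter_upwards [hslln, hlim] with ω hω hωl
  refine Metric.tendsto_atTop.2 fun ε hε => ?_
  obtain ⟨m, hm⟩ := (hmean.eventually_lt_const (half_pos hε)).exists
  obtain ⟨K, hK⟩ := eventually_atTop.1 ((hω m).eventually_lt_const (hm.trans (half_lt_self hε)))
  -- when `k n < K`, only finitely many `l` occur, and each is dealt with separately
  have hfirst : ∀ᶠ n in atTop, ∀ l ∈ Finset.range K, g n (Θ l ω) < ε / 2 :=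
    (Finset.eventually_all _).2 fun l _ => (hωl l).eventually_lt_const (half_pos hε)
  obtain ⟨N, hN⟩ := eventually_atTop.1 hfirst
  refine ⟨max m N, fun n hn => ?_⟩
  rw [Real.dist_eq, sub_zero,
    abs_of_nonneg (div_nonneg (Finset.sum_nonneg fun _ _ => hg0 _ _) (Nat.cast_nonneg _))]
  rcases le_total K (k n) with hkn | hkn
  · refine lt_of_le_of_lt ?_ (hK (k n) hkn)
    gcongr with l _
    exact hgG _ (le_of_max_le_left hn)
  · refine lt_of_le_of_lt (div_le_of_le_mul₀ (Nat.cast_nonneg _) (half_pos hε).le ?_)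
      (half_lt_self hε)
    refine (Finset.sum_le_card_nsmul _ _ (ε / 2) fun l hl => ?_).trans ?_
    · exact (hN n (le_of_max_le_right hn) l
        (Finset.mem_range.2 ((Finset.mem_range.1 hl).trans_le hkn))).le
    · rw [Finset.card_range, nsmul_eq_mul, mul_comm]

/-- A version of `ae_tendsto_average_zero` with an additional variable `D`, independent of the
copies that are averaged. -/
theorem ae_tendsto_average_zero_of_indepFun {Ω α β : Type*} [MeasurableSpace Ω]
    [MeasurableSpace α] [MeasurableSpace β] {μ : Measure Ω} [IsProbabilityMeasure μ]
    {Θ : ℕ → Ω → α} (hΘ : ∀ l, Measurable (Θ l)) (hindep : iIndepFun Θ μ)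
    (hident : ∀ l, IdentDistrib (Θ l) (Θ 0) μ μ) {D : Ω → β} (hD : Measurable D)
    (hΘD : IndepFun (fun ω l => Θ l ω) D μ)
    {g : ℕ → α × β → ℝ} (hg : ∀ n, Measurable (g n)) (hg0 : ∀ n a, 0 ≤ g n a)
    (hg1 : ∀ n a, g n a ≤ 1) (k : ℕ → ℕ)
    (hlim : ∀ l, ∀ᵐ ω ∂μ, Tendsto (fun n => g n (Θ l ω, D ω)) atTop (𝓝 0)) :
    ∀ᵐ ω ∂μ, Tendsto (fun n => (∑ l ∈ Finset.range (k n), g n (Θ l ω, D ω)) / (k n : ℝ))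
      atTop (𝓝 0) := by
  have hΘm : Measurable fun ω l => Θ l ω := measurable_pi_lambda _ hΘ
  have hmap := (indepFun_iff_map_prod_eq_prod_map_map hD.aemeasurable hΘm.aemeasurable).1 hΘD.symm
  have : IsProbabilityMeasure (μ.map D) := Measure.isProbabilityMeasure_map hD.aemeasurable
  have : IsProbabilityMeasure (μ.map fun ω l => Θ l ω) :=
    Measure.isProbabilityMeasure_map hΘm.aemeasurable
  -- transfer of almost sure events between `Ω` and its two factors
  have htrans : ∀ p : β × (ℕ → α) → Prop, MeasurableSet {z | p z} →
      ((∀ᵐ ω ∂μ, p (D ω, fun l => Θ l ω)) ↔ ∀ᵐ u ∂μ.map D, ∀ᵐ ω ∂μ, p (u, fun l => Θ l ω)) := by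
    intro p hp
    rw [← ae_map_iff (f := fun ω => (D ω, fun l => Θ l ω)) (hD.prodMk hΘm).aemeasurable hp, hmap,
      Measure.ae_prod_iff_ae_ae hp]
    refine eventually_congr (Eventually.of_forall fun u => ?_)
    exact ae_map_iff hΘm.aemeasurable (measurable_prodMk_left hp)
  have hmeas : ∀ n l, Measurable fun z : β × (ℕ → α) => g n (z.2 l, z.1) := fun n l =>
    (hg n).comp (((measurable_pi_apply l).comp measurable_snd).prodMk measurable_fst)
  have hlim' := (htrans (fun z => ∀ l, Tendsto (fun n => g n (z.2 l, z.1)) atTop (𝓝 0)) (by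
    simp only [Set.ofPred_forall]
    exact MeasurableSet.iInter fun l => measurableSet_tendsto _ fun n => hmeas n l)).1
      (ae_all_iff.2 hlim)
  refine (htrans (fun z => Tendsto (fun n => (∑ l ∈ Finset.range (k n), g n (z.2 l, z.1)) /
    (k n : ℝ)) atTop (𝓝 0)) (measurableSet_tendsto _ fun n =>
      (Finset.measurable_fun_sum _ fun l _ => hmeas n l).div_const _)).2 ?_
  filter_upwards [hlim'] with u hu
  exact ae_tendsto_average_zero hΘ hindep hident (g := fun n a => g n (a, u))
    (fun n => (hg n).comp measurable_prodMk_right) (fun _ _ => hg0 _ _) (fun _ _ => hg1 _ _) k hu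

/-! ### Uniform convergence of distribution functions -/

/-- **Pólya's theorem**, for a random distribution function: pointwise almost sure convergence to
a continuous distribution function is uniform. -/
theorem ae_tendsto_iSup_abs_sub_of_monotone {Ω : Type*} [MeasurableSpace Ω] {μ : Measure Ω}
    {F : ℕ → Ω → ℝ → ℝ} (hF : ∀ n ω, Monotone (F n ω)) (hF0 : ∀ n ω y, 0 ≤ F n ω y)
    (hF1 : ∀ n ω y, F n ω y ≤ 1) {G : ℝ → ℝ} (hG : Monotone G) (hGc : Continuous G)
    (hbot : Tendsto G atBot (𝓝 0)) (htop : Tendsto G atTop (𝓝 1))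
    (hlim : ∀ y, ∀ᵐ ω ∂μ, Tendsto (fun n => F n ω y) atTop (𝓝 (G y))) :
    ∀ᵐ ω ∂μ, Tendsto (fun n => ⨆ y, |F n ω y - G y|) atTop (𝓝 0) := by
  have hG0 : ∀ y, 0 ≤ G y := fun y => hG.le_of_tendsto hbot y
  have hG1 : ∀ y, G y ≤ 1 := fun y => hG.ge_of_tendsto htop y
  have hsurj : ∀ u ∈ Set.Ioo (0 : ℝ) 1, ∃ y, G y = u := by
    intro u hu
    obtain ⟨a, ha⟩ := (hbot.eventually_lt_const hu.1).exists
    obtain ⟨b, hb⟩ := (htop.eventually_const_lt hu.2).exists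
    exact mem_range_of_exists_le_of_exists_ge hGc ⟨a, ha.le⟩ ⟨b, hb.le⟩
  choose! q hq using hsurj
  -- convergence at the quantiles of rational orders is enough
  have hrat : ∀ᵐ ω ∂μ, ∀ r : ℚ, Tendsto (fun n => F n ω (q r)) atTop (𝓝 (G (q r))) :=
    ae_all_iff.2 fun r => hlim _
  filter_upwards [hrat] with ω hω
  refine Metric.tendsto_atTop.2 fun ε hε => ?_
  obtain ⟨m, hm0, hm⟩ : ∃ m : ℕ, 0 < m ∧ 2 / (m : ℝ) < ε := by
    obtain ⟨m, hm⟩ := exists_nat_gt (2 / ε)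
    have hm0 : (0 : ℝ) < m := lt_trans (by positivity) hm
    exact ⟨m, by exact_mod_cast hm0, by rwa [div_lt_comm₀ hm0 hε] ⟩
  have hmpos : (0 : ℝ) < m := by exact_mod_cast hm0
  have hev : ∀ᶠ n in atTop, ∀ i ∈ Finset.range m,
      |F n ω (q ((i / m : ℚ) : ℝ)) - G (q ((i / m : ℚ) : ℝ))| < 1 / m :=
    (Finset.eventually_all _).2 fun i _ => by
      have := Metric.tendsto_nhds.1 (hω (i / m)) (1 / m) (by positivity)
      simpa only [Real.dist_eq] using this
  obtain ⟨N, hN⟩ := eventually_atTop.1 hev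
  refine ⟨N, fun n hn => ?_⟩
  rw [Real.dist_eq, sub_zero, abs_of_nonneg (Real.iSup_nonneg fun _ => abs_nonneg _)]
  refine lt_of_le_of_lt (ciSup_le fun y => ?_) hm
  have hpt : ∀ i : ℕ, 0 < i → i < m → ∃ z, G z = i / m ∧ |F n ω z - i / m| < 1 / m := by
    intro i hi him
    have h1 : G (q ((i / m : ℚ) : ℝ)) = i / m := by
      rw [hq]
      · push_cast; rfl
      · push_cast
        exact ⟨by positivity, by rw [div_lt_one hmpos]; exact_mod_cast him⟩
    refine ⟨_, h1, ?_⟩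
    have := hN n hn i (Finset.mem_range.2 him)
    rwa [h1] at this
  have e2 : (2 : ℝ) / m = 1 / m + 1 / m := by ring
  rw [abs_le]
  constructor
  · have hc : G y * m ≤ ⌈G y * m⌉₊ := Nat.le_ceil _
    have hc' := Nat.ceil_lt_add_one (mul_nonneg (hG0 y) hmpos.le)
    rcases Nat.lt_or_ge ⌈G y * m⌉₊ 2 with h | h
    · have h1 : (⌈G y * m⌉₊ : ℝ) ≤ 1 := by exact_mod_cast Nat.lt_succ_iff.1 h
      have h2 : G y ≤ 1 / m := by
        rw [le_div_iff₀ hmpos]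
        linarith
      have := hF0 n ω y
      have : 0 < 1 / (m : ℝ) := by positivity
      linarith
    -- here `j / m < G y ≤ (j + 1) / m` with `0 < j`
    · obtain ⟨j, hj⟩ := Nat.exists_eq_add_of_le h
      rw [hj] at hc hc'
      push_cast at hc hc'
      have h1 : ((1 + j : ℕ) : ℝ) < G y * m := by push_cast; linarith
      have hjm : 1 + j < m := by
        have : G y * m ≤ m := mul_le_of_le_one_left hmpos.le (hG1 y)
        exact_mod_cast h1.trans_le this
      obtain ⟨z, hz, hFz⟩ := hpt (1 + j) (by omega) hjm
      have hzy : z ≤ y := by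
        by_contra! hyz
        have := hG hyz.le
        rw [hz, le_div_iff₀ hmpos] at this
        linarith
      have h2 : G y ≤ ((1 + j : ℕ) : ℝ) / m + 1 / m := by
        rw [← add_div, le_div_iff₀ hmpos]
        push_cast
        linarith
      have := (abs_lt.1 hFz).1
      have := hF n ω hzy
      linarith
  -- here `i / m ≤ G y < (i + 1) / m`
  · set i := ⌊G y * m⌋₊
    have hi1 : (i : ℝ) / m ≤ G y := by
      rw [div_le_iff₀ hmpos]
      exact Nat.floor_le (mul_nonneg (hG0 y) hmpos.le)
    have hi2 : G y < (i + 1) / m := by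
      rw [lt_div_iff₀ hmpos]
      exact Nat.lt_floor_add_one _
    have e1 : ((i : ℝ) + 1) / m = i / m + 1 / m := by ring
    rcases lt_or_ge (i + 1) m with him | him
    · obtain ⟨z, hz, hFz⟩ := hpt (i + 1) (Nat.succ_pos i) him
      push_cast at hz hFz
      have hle := (abs_lt.1 hFz).2
      have hyz : y ≤ z := by
        by_contra! h
        have := hG h.le
        rw [hz] at this
        linarith
      have := hF n ω hyz
      linarith
    · have h1 : (1 : ℝ) ≤ (i + 1) / m := by
        rw [one_le_div hmpos]
        exact_mod_cast him
      have := hF1 n ω y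
      have : 0 < 1 / (m : ℝ) := by positivity
      linarith

/-! ### Cells as traces of boxes -/

/-- For `A ⊆ 𝒳`, this says that `A` is the trace on `𝒳` of an axis-parallel box, whose sides may
be open, closed or infinite: `A` contains each point of `𝒳` that lies between points of `A` in
every coordinate. -/
def IsBoxTrace {d : ℕ} (𝒳 A : Set (Fin d → ℝ)) : Prop :=
  ∀ u ∈ 𝒳, (∀ i, ∃ v ∈ A, v i ≤ u i) → (∀ i, ∃ w ∈ A, u i ≤ w i) → u ∈ A

theorem leafCell_subset {d : ℕ} (T : SplitTree d) (A : Set (Fin d → ℝ)) (x : Fin d → ℝ) :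
    leafCell T A x ⊆ A := by
  induction T generalizing A with
  | leaf => exact subset_rfl
  | node i z l r hl hr =>
    simp only [leafCell]
    split_ifs
    · exact (hl _).trans Set.inter_subset_left
    · exact (hr _).trans Set.inter_subset_left

theorem IsBoxTrace.leafCell {d : ℕ} {𝒳 : Set (Fin d → ℝ)} (T : SplitTree d)
    {A : Set (Fin d → ℝ)} (hA : IsBoxTrace 𝒳 A) (x : Fin d → ℝ) :
    IsBoxTrace 𝒳 (leafCell T A x) := by
  induction T generalizing A with
  | leaf => exact hA
  | node i z l r hl hr =>
    simp only [_root_.leafCell]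
    split_ifs
    · refine hl fun u hu hv hw => ⟨hA u hu ?_ ?_, ?_⟩
      · exact fun j => (hv j).imp fun v h => ⟨h.1.1, h.2⟩
      · exact fun j => (hw j).imp fun v h => ⟨h.1.1, h.2⟩
      · obtain ⟨w, hwA, hle⟩ := hw i
        exact lt_of_le_of_lt hle hwA.2
    · refine hr fun u hu hv hw => ⟨hA u hu ?_ ?_, ?_⟩
      · exact fun j => (hv j).imp fun v h => ⟨h.1.1, h.2⟩
      · exact fun j => (hw j).imp fun v h => ⟨h.1.1, h.2⟩
      · obtain ⟨v, hvA, hle⟩ := hv i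
        exact le_trans hvA.2 hle

/-- The points of a finite sample that fall into the trace of a box are those that fall into the
closed box they span; a corner of this box has its `i`-th coordinate from one of these points. Thus
boxes pick out at most `n ^ (2 * d)` nonempty parts of a sample of size `n`. -/
theorem IsBoxTrace.exists_corners {d n : ℕ} {𝒳 A : Set (Fin d → ℝ)} (hA : IsBoxTrace 𝒳 A)
    (hA𝒳 : A ⊆ 𝒳) (X : Fin n → Fin d → ℝ) {j₀ : Fin n} (hj₀ : X j₀ ∈ A) :
    ∃ p q : Fin d → Fin n, ∀ j, X j ∈ A ↔
      X j ∈ 𝒳 ∩ Set.Icc (fun i => X (p i) i) (fun i => X (q i) i) := by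
  classical
  have hne : (Finset.univ.filter fun j => X j ∈ A).Nonempty := ⟨j₀, by simpa using hj₀⟩
  choose p hp using fun i => Finset.exists_min_image _ (fun j => X j i) hne
  choose q hq using fun i => Finset.exists_max_image _ (fun j => X j i) hne
  simp only [Finset.mem_filter, Finset.mem_univ, true_and] at hp hq
  refine ⟨p, q, fun j => ⟨fun hj => ⟨hA𝒳 hj, fun i => (hp i).2 j hj, fun i => (hq i).2 j hj⟩, ?_⟩⟩
  rintro ⟨hj, hle, hge⟩
  exact hA _ hj (fun i => ⟨_, (hp i).1, hle i⟩) fun i => ⟨_, (hq i).1, hge i⟩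

/-! ### Uniform deviations over cells -/

/-- Hoeffding's inequality for the sums of `G b (D j)`, `j < n`, when the parameter `b` is chosen
as a function of the `D j` with `j ∈ T`: these terms are left out, the other ones being independent
of `b`. -/
theorem measure_lt_abs_sum_param_le {Ω E β : Type*} [MeasurableSpace Ω] [MeasurableSpace E]
    [MeasurableSpace β] {μ : Measure Ω} [IsProbabilityMeasure μ] {D : ℕ → Ω → E}
    (hD : ∀ j, Measurable (D j)) (hindep : iIndepFun D μ) {P : Measure E}
    (hlaw : ∀ j, μ.map (D j) = P) {G : β × E → ℝ} (hG : Measurable G) (hG1 : ∀ z, |G z| ≤ 1)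
    (hG0 : ∀ b, ∫ e, G (b, e) ∂P = 0) (T : Finset ℕ) {φ : (T → E) → β} (hφ : Measurable φ)
    (n : ℕ) {t : ℝ} (ht : 0 ≤ t) :
    μ {ω | t + T.card < |∑ j ∈ Finset.range n, G (φ fun j => D j ω, D j ω)|} ≤
      2 * ENNReal.ofReal (Real.exp (-t ^ 2 / (2 * n))) := by
  classical
  set R := Finset.range n \ T with hR
  have hV : Measurable fun ω (j : R) => D j ω := measurable_pi_lambda _ fun j => hD j
  have hU : Measurable fun ω (j : T) => D j ω := measurable_pi_lambda _ fun j => hD j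
  have hind : IndepFun (fun ω (j : T) => D j ω) (fun ω (j : R) => D j ω) μ :=
    hindep.indepFun_finset T R Finset.disjoint_sdiff hD
  have hS : MeasurableSet {z : (T → E) × (R → E) | t < |∑ j : R, G (φ z.1, z.2 j)|} := by
    refine measurableSet_lt measurable_const ?_
    refine Measurable.abs (Finset.measurable_fun_sum _ fun j _ => hG.comp ?_)
    exact (hφ.comp measurable_fst).prodMk ((measurable_pi_apply j).comp measurable_snd)
  refine le_trans (measure_mono ?_) (measure_indepFun_pair_le hU hV hind hS fun u => ?_)
  · intro ω hω
    rw [Set.mem_ofPred_eq] at hω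
    have h1 : |∑ j ∈ Finset.range n ∩ T, G (φ fun j => D j ω, D j ω)| ≤ T.card := by
      refine (Finset.abs_sum_le_sum_abs _ _).trans ?_
      refine (Finset.sum_le_card_nsmul _ _ 1 fun j _ => hG1 _).trans ?_
      rw [nsmul_eq_mul, mul_one]
      exact_mod_cast Finset.card_le_card Finset.inter_subset_right
    have h2 : ∑ j ∈ Finset.range n, G (φ fun j => D j ω, D j ω) =
        ∑ j ∈ Finset.range n ∩ T, G (φ fun j => D j ω, D j ω) +
          ∑ j ∈ R, G (φ fun j => D j ω, D j ω) := (Finset.sum_inter_add_sum_sdiff _ _ _).symm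
    rw [h2] at hω
    have h3 := abs_add_le (∑ j ∈ Finset.range n ∩ T, G (φ fun j => D j ω, D j ω))
      (∑ j ∈ R, G (φ fun j => D j ω, D j ω))
    simp only [Set.mem_ofPred_eq]
    rw [Finset.sum_coe_sort R fun j => G (φ fun j => D j ω, D j ω)]
    linarith
  · have hGu : Measurable fun e => G (φ u, e) := hG.comp measurable_prodMk_left
    have := measure_lt_abs_sum_le (μ := μ) (X := fun j ω => G (φ u, D j ω))
      (hindep.comp (fun _ e => G (φ u, e)) fun _ => hGu) (fun j => hGu.comp (hD j))
      (fun j ω => hG1 _) (fun j => by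
        rw [← hG0 (φ u), ← hlaw j, integral_map (hD j).aemeasurable hGu.aestronglyMeasurable])
      (s := R) (n := n) ((Finset.card_le_card Finset.sdiff_subset).trans
        (Finset.card_range n).le) ht
    refine le_trans (measure_mono fun ω (hω : t < _) => ?_) this
    rwa [Finset.sum_coe_sort R fun j => G (φ u, D j ω)] at hω

/-- Empirical sums of `h` over cells, for a function `h` centred given the covariates, are at most
of order `√n log n`, uniformly over the cells. -/
theorem ae_eventually_abs_sum_indicator_mul_le {Ω : Type*} [MeasurableSpace Ω] {μ : Measure Ω}
    [IsProbabilityMeasure μ] {d : ℕ} {𝒳 : Set (Fin d → ℝ)} (h𝒳 : MeasurableSet 𝒳)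
    {D : ℕ → Ω → (Fin d → ℝ) × ℝ} (hD : ∀ j, Measurable (D j)) (hindep : iIndepFun D μ)
    {P : Measure ((Fin d → ℝ) × ℝ)} (hlaw : ∀ j, μ.map (D j) = P) {h : (Fin d → ℝ) × ℝ → ℝ}
    (hm : Measurable h) (h1 : ∀ e, |h e| ≤ 1)
    (h0 : ∀ B : Set (Fin d → ℝ), MeasurableSet B → ∫ e, B.indicator (fun _ => 1) e.1 * h e ∂P = 0) :
    ∀ᵐ ω ∂μ, ∀ᶠ n : ℕ in atTop, ∀ A ⊆ 𝒳, IsBoxTrace 𝒳 A →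
      |∑ j : Fin n, A.indicator (fun _ => 1) (D j ω).1 * h (D j ω)| ≤
        √(n : ℝ) * Real.log n + 2 * d := by
  classical
  set G : ((Fin d → ℝ) × (Fin d → ℝ)) × ((Fin d → ℝ) × ℝ) → ℝ := fun z =>
    (𝒳 ∩ Set.Icc z.1.1 z.1.2).indicator (fun _ => 1) z.2.1 * h z.2 with hGdef
  have hG : Measurable G := by
    refine Measurable.mul ?_ (hm.comp measurable_snd)
    have hset : MeasurableSet {z : ((Fin d → ℝ) × (Fin d → ℝ)) × ((Fin d → ℝ) × ℝ) |
        z.2.1 ∈ 𝒳 ∩ Set.Icc z.1.1 z.1.2} := by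
      refine MeasurableSet.inter (measurable_snd.fst h𝒳) (MeasurableSet.inter ?_ ?_)
      · exact measurableSet_le measurable_fst.fst measurable_snd.fst
      · exact measurableSet_le measurable_snd.fst measurable_fst.snd
    exact (measurable_const (a := (1 : ℝ))).indicator hset
  have hind : ∀ (B : Set (Fin d → ℝ)) x, |B.indicator (fun _ => (1 : ℝ)) x| ≤ 1 := fun B x => by
    by_cases hx : x ∈ B <;> simp [hx]
  have hG1 : ∀ z, |G z| ≤ 1 := fun z => by
    rw [hGdef, abs_mul]
    exact mul_le_one₀ (hind _ _) (abs_nonneg _) (h1 _)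
  have hG0 : ∀ b, ∫ e, G (b, e) ∂P = 0 := fun b =>
    h0 (𝒳 ∩ Set.Icc b.1 b.2) (h𝒳.inter measurableSet_Icc)
  set bad : (n : ℕ) → (Fin d → Fin n) × (Fin d → Fin n) → Set Ω := fun n c =>
    {ω | √(n : ℝ) * Real.log n + 2 * d < |∑ j ∈ Finset.range n,
      G ((fun i => (D (c.1 i) ω).1 i, fun i => (D (c.2 i) ω).1 i), D j ω)|} with hbad
  have hbadle : ∀ n c, μ (bad n c) ≤
      2 * ENNReal.ofReal (Real.exp (-(√(n : ℝ) * Real.log n) ^ 2 / (2 * n))) := by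
    intro n c
    set T : Finset ℕ := Finset.univ.image (fun i => (c.1 i : ℕ)) ∪
      Finset.univ.image (fun i => (c.2 i : ℕ)) with hT
    have hT1 : ∀ i, (c.1 i : ℕ) ∈ T := fun i => Finset.mem_union_left _ (by simp)
    have hT2 : ∀ i, (c.2 i : ℕ) ∈ T := fun i => Finset.mem_union_right _ (by simp)
    have hcard : (T.card : ℝ) ≤ 2 * d := by
      have : T.card ≤ 2 * d := by
        refine (Finset.card_union_le _ _).trans ?_
        rw [two_mul]
        exact add_le_add (Finset.card_image_le.trans (by simp))
          (Finset.card_image_le.trans (by simp))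
      exact_mod_cast this
    have hφ : Measurable fun w : T → (Fin d → ℝ) × ℝ =>
        ((fun i => (w ⟨_, hT1 i⟩).1 i : Fin d → ℝ), (fun i => (w ⟨_, hT2 i⟩).1 i : Fin d → ℝ)) := by
      refine Measurable.prodMk ?_ ?_ <;>
      exact measurable_pi_lambda _ fun i =>
        (measurable_pi_apply i).comp (measurable_fst.comp (measurable_pi_apply _))
    refine le_trans (measure_mono ?_)
      (measure_lt_abs_sum_param_le hD hindep hlaw hG hG1 hG0 T hφ n (t := √(n : ℝ) * Real.log n)
        (mul_nonneg (Real.sqrt_nonneg _) (Real.log_natCast_nonneg n)))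
    intro ω hω
    rw [hbad, Set.mem_ofPred_eq] at hω
    rw [Set.mem_ofPred_eq]
    exact lt_of_le_of_lt (by gcongr) hω
  have hunion : ∀ n, μ (⋃ c, bad n c) ≤ (n : ENNReal) ^ (2 * d) *
      (2 * ENNReal.ofReal (Real.exp (-(√(n : ℝ) * Real.log n) ^ 2 / (2 * n)))) := fun n => by
    refine (measure_iUnion_fintype_le μ _).trans
      ((Finset.sum_le_sum fun c _ => hbadle n c).trans ?_)
    simp [two_mul d, pow_add]
  filter_upwards [ae_eventually_notMem (ne_top_of_le_ne_top
    (tsum_mul_exp_log_sq_ne_top (2 * d)) (ENNReal.tsum_le_tsum hunion))] with ω hω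
  filter_upwards [hω] with n hn A hA𝒳 hA
  have hpos : 0 ≤ √(n : ℝ) * Real.log n + 2 * d :=
    add_nonneg (mul_nonneg (Real.sqrt_nonneg _) (Real.log_natCast_nonneg n)) (by positivity)
  by_cases hex : ∃ j : Fin n, (D j ω).1 ∈ A
  · obtain ⟨j₀, hj₀⟩ := hex
    obtain ⟨p, q, hpq⟩ := hA.exists_corners hA𝒳 (fun j : Fin n => (D j ω).1) hj₀
    by_contra! hlt
    refine hn (Set.mem_iUnion.2 ⟨(p, q), ?_⟩)
    rw [hbad, Set.mem_ofPred_eq, ← Fin.sum_univ_eq_sum_range fun j => G ((fun i => (D (p i) ω).1 i,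
      fun i => (D (q i) ω).1 i), D j ω)]
    refine lt_of_lt_of_eq hlt (congrArg _ (Finset.sum_congr rfl fun j _ => ?_))
    simp only [hGdef, Set.indicator_apply, hpq j]
  · push Not at hex
    rw [Finset.sum_eq_zero fun j _ => by simp [hex j], abs_zero]
    exact hpos

/-- Hoeffding's inequality for a sum of values at `n` indices drawn uniformly with replacement. -/
theorem measure_lt_abs_sum_draws_le {Ω : Type*} [MeasurableSpace Ω] {μ : Measure Ω}
    [IsProbabilityMeasure μ] {n : ℕ} {I : Ω → Fin n → Fin n} (hI : Measurable I)
    (hunif : ∀ f, μ {ω | I ω = f} = ((n : ENNReal) ^ n)⁻¹) {c : Fin n → ℝ}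
    (hc0 : ∀ j, 0 ≤ c j) (hc1 : ∀ j, c j ≤ 1) {t : ℝ} (ht : 0 ≤ t) :
    μ {ω | t < |∑ i, c (I ω i) - ∑ j, c j|} ≤
      2 * ENNReal.ofReal (Real.exp (-t ^ 2 / (2 * n))) := by
  rcases Nat.eq_zero_or_pos n with rfl | hn
  · simp [not_lt.2 ht]
  have : Nonempty (Fin n) := ⟨⟨0, hn⟩⟩
  set ν : Measure (Fin n) := uniformOn Set.univ with hν
  have : IsProbabilityMeasure ν := isProbabilityMeasure_uniformOn Set.finite_univ Set.univ_nonempty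
  have hν1 : ∀ j, ν {j} = (n : ENNReal)⁻¹ := fun j => by
    simp [hν, uniformOn_univ]
  have hlaw : μ.map I = Measure.pi fun _ => ν := by
    refine Measure.ext_of_singleton fun f => ?_
    rw [Measure.map_apply hI (measurableSet_singleton f), Measure.pi_singleton]
    simp only [hν1, Finset.prod_const, Finset.card_univ, Fintype.card_fin]
    rw [← ENNReal.inv_pow]
    exact hunif f
  have hn' : (n : ℝ) ≠ 0 := by exact_mod_cast hn.ne'
  set b : ℝ := (∑ j, c j) / n with hb
  have hb0 : 0 ≤ b := div_nonneg (Finset.sum_nonneg fun j _ => hc0 j) (Nat.cast_nonneg n)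
  have hb1 : b ≤ 1 := by
    refine div_le_one_of_le₀ ?_ (Nat.cast_nonneg n)
    simpa using Finset.sum_le_card_nsmul Finset.univ c 1 fun j _ => hc1 j
  have hmean : ∀ i : Fin n, ∫ f : Fin n → Fin n, (c (f i) - b) ∂(Measure.pi fun _ => ν) = 0 := by
    intro i
    rw [integral_comp_eval (μ := fun _ : Fin n => ν) (i := i) (f := fun j => c j - b)
      (Measurable.of_discrete.aestronglyMeasurable), integral_fintype .of_finite]
    simp only [measureReal_def, hν1, ENNReal.toReal_inv, ENNReal.toReal_natCast, smul_eq_mul]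
    rw [← Finset.mul_sum, Finset.sum_sub_distrib, Finset.sum_const, Finset.card_univ,
      Fintype.card_fin, nsmul_eq_mul, hb, mul_div_cancel₀ _ hn', sub_self, mul_zero]
  have := measure_lt_abs_sum_le (μ := Measure.pi fun _ : Fin n => ν)
    (X := fun i f => c (f i) - b)
    (iIndepFun_pi (X := fun _ j => c j - b) fun i => Measurable.of_discrete.aemeasurable)
    (fun i => Measurable.of_discrete) (fun i f => abs_le.2
      ⟨by linarith [hc0 (f i)], by linarith [hc1 (f i)]⟩) hmean (s := Finset.univ) (n := n)
    (by simp) ht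
  rw [← hlaw, Measure.map_apply hI .of_discrete] at this
  refine le_trans (measure_mono fun ω (hω : t < _) => ?_) this
  change t < |∑ i, (c (I ω i) - b)|
  rwa [Finset.sum_sub_distrib, Finset.sum_const, Finset.card_univ, Fintype.card_fin, nsmul_eq_mul,
    hb, mul_div_cancel₀ _ hn']

theorem countIn_eq_sum_indicator {d n : ℕ} (S : Fin n → (Fin d → ℝ) × ℝ) (A : Set (Fin d → ℝ)) :
    (countIn S A : ℝ) = ∑ j, A.indicator (fun _ => 1) (S j).1 := by
  classical
  simp [countIn, obsIn, Set.indicator_apply]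

theorem countIn_le {d n : ℕ} (S : Fin n → (Fin d → ℝ) × ℝ) (A : Set (Fin d → ℝ)) :
    countIn S A ≤ n :=
  (Finset.card_le_univ _).trans_eq (Fintype.card_fin n)

/-- The numbers of bootstrap and of original observations in a cell differ at most by `√n log n`,
uniformly over the cells. -/
theorem ae_eventually_abs_countIn_bootstrap_sub_le {Ω : Type*} [MeasurableSpace Ω] {μ : Measure Ω}
    [IsProbabilityMeasure μ] {d : ℕ} {𝒳 : Set (Fin d → ℝ)} (h𝒳 : MeasurableSet 𝒳)
    {D : ℕ → Ω → (Fin d → ℝ) × ℝ} (hD : ∀ j, Measurable (D j)) {θ : Ω → TreeSeed d}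
    (hθ : Measurable θ) (hθD : IndepFun θ (fun ω j => D j ω) μ)
    (hunif : ∀ (n : ℕ) (f : Fin n → Fin n), μ {ω | (θ ω n).1 = f} = ((n : ENNReal) ^ n)⁻¹) :
    ∀ᵐ ω ∂μ, ∀ᶠ n : ℕ in atTop, ∀ A ⊆ 𝒳, IsBoxTrace 𝒳 A →
      |(countIn (bootstrapSample D θ n ω) A : ℝ) - countIn (trainingSample D n ω) A| ≤
        √(n : ℝ) * Real.log n := by
  classical
  -- the indicator of the closed box spanned by the observations with the indices in `c`
  set C : (n : ℕ) → (Fin d → Fin n) × (Fin d → Fin n) → (ℕ → (Fin d → ℝ) × ℝ) → Fin n → ℝ :=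
    fun n c u j => (𝒳 ∩ Set.Icc (fun i => (u (c.1 i)).1 i) (fun i => (u (c.2 i)).1 i)).indicator
      (fun _ => 1) (u j).1 with hC
  have hCm : ∀ n c j, Measurable fun u => C n c u j := fun n c j => by
    have hX : ∀ j : ℕ, Measurable fun u : ℕ → (Fin d → ℝ) × ℝ => (u j).1 := fun j =>
      measurable_fst.comp (measurable_pi_apply j)
    have hcorner : ∀ p : Fin d → Fin n, Measurable fun u : ℕ → (Fin d → ℝ) × ℝ =>
        (fun i => (u (p i)).1 i : Fin d → ℝ) := fun p =>
      measurable_pi_lambda _ fun i => (measurable_pi_apply i).comp (hX _)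
    have hset : MeasurableSet {u : ℕ → (Fin d → ℝ) × ℝ | (u j).1 ∈ 𝒳 ∩
        Set.Icc (fun i => (u (c.1 i)).1 i) (fun i => (u (c.2 i)).1 i)} :=
      MeasurableSet.inter (hX j h𝒳) (MeasurableSet.inter
        (measurableSet_le (hcorner _) (hX j)) (measurableSet_le (hX j) (hcorner _)))
    exact (measurable_const (a := (1 : ℝ))).indicator hset
  set bad : (n : ℕ) → (Fin d → Fin n) × (Fin d → Fin n) → Set Ω := fun n c =>
    {ω | √(n : ℝ) * Real.log n < |∑ i, C n c (fun j => D j ω) ((θ ω n).1 i) -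
      ∑ j, C n c (fun j => D j ω) j|} with hbad
  have hdraws : ∀ n, Measurable fun ω => (θ ω n).1 := fun n =>
    measurable_fst.comp ((measurable_pi_apply n).comp hθ)
  have hDm : Measurable fun ω j => D j ω := measurable_pi_lambda _ hD
  have hbadle : ∀ n c, μ (bad n c) ≤
      2 * ENNReal.ofReal (Real.exp (-(√(n : ℝ) * Real.log n) ^ 2 / (2 * n))) := by
    intro n c
    have hS : MeasurableSet {z : (ℕ → (Fin d → ℝ) × ℝ) × (Fin n → Fin n) |
        √(n : ℝ) * Real.log n < |∑ i, C n c z.1 (z.2 i) - ∑ j, C n c z.1 j|} := by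
      refine measurableSet_lt measurable_const (measurable_from_prod_countable_left fun f => ?_)
      exact ((Finset.measurable_fun_sum _ fun i _ => hCm n c (f i)).sub
        (Finset.measurable_fun_sum _ fun j _ => hCm n c j)).abs
    have hind : IndepFun (fun ω j => D j ω) (fun ω => (θ ω n).1) μ :=
      hθD.symm.comp measurable_id (measurable_fst.comp (measurable_pi_apply n))
    refine measure_indepFun_pair_le hDm (hdraws n) hind hS fun u => ?_
    refine measure_lt_abs_sum_draws_le (hdraws n) (hunif n) (c := C n c u) (fun j => ?_)
      (fun j => ?_) (mul_nonneg (Real.sqrt_nonneg _) (Real.log_natCast_nonneg n))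
    · exact Set.indicator_nonneg (fun _ _ => zero_le_one) _
    · exact Set.indicator_le_self' (fun _ _ => zero_le_one) _
  have hunion : ∀ n, μ (⋃ c, bad n c) ≤ (n : ENNReal) ^ (2 * d) *
      (2 * ENNReal.ofReal (Real.exp (-(√(n : ℝ) * Real.log n) ^ 2 / (2 * n)))) := fun n => by
    refine (measure_iUnion_fintype_le μ _).trans
      ((Finset.sum_le_sum fun c _ => hbadle n c).trans ?_)
    simp [two_mul d, pow_add]
  filter_upwards [ae_eventually_notMem (ne_top_of_le_ne_top
    (tsum_mul_exp_log_sq_ne_top (2 * d)) (ENNReal.tsum_le_tsum hunion))] with ω hω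
  filter_upwards [hω] with n hn A hA𝒳 hA
  rw [countIn_eq_sum_indicator, countIn_eq_sum_indicator]
  by_cases hex : ∃ j : Fin n, (D j ω).1 ∈ A
  · obtain ⟨j₀, hj₀⟩ := hex
    obtain ⟨p, q, hpq⟩ := hA.exists_corners hA𝒳 (fun j : Fin n => (D j ω).1) hj₀
    by_contra! hlt
    refine hn (Set.mem_iUnion.2 ⟨(p, q), ?_⟩)
    have hCA : ∀ j : Fin n, C n (p, q) (fun j => D j ω) j =
        A.indicator (fun _ => 1) (D j ω).1 := fun j => by
      simp only [hC, Set.indicator_apply, hpq j]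
    rw [hbad, Set.mem_ofPred_eq]
    simp only [hCA]
    exact hlt
  · push Not at hex
    have hz : ∀ j : Fin n, A.indicator (fun _ => (1 : ℝ)) (D j ω).1 = 0 := fun j => by simp [hex j]
    simp only [bootstrapSample, trainingSample, hz, Finset.sum_const_zero, sub_self, abs_zero]
    exact mul_nonneg (Real.sqrt_nonneg _) (Real.log_natCast_nonneg n)

/-! ### The conditional distribution function -/

theorem condDistFun_eq_cdf {d : ℕ} (κ : Kernel (Fin d → ℝ) ℝ) [IsMarkovKernel κ]
    (x : Fin d → ℝ) : condDistFun κ x = cdf (κ x) := by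
  ext y
  rw [condDistFun, cdf_eq_real]

theorem condDistFun_nonneg {d : ℕ} (κ : Kernel (Fin d → ℝ) ℝ) (x : Fin d → ℝ) (y : ℝ) :
    0 ≤ condDistFun κ x y := measureReal_nonneg

theorem condDistFun_le_one {d : ℕ} (κ : Kernel (Fin d → ℝ) ℝ) [IsMarkovKernel κ]
    (x : Fin d → ℝ) (y : ℝ) : condDistFun κ x y ≤ 1 := measureReal_le_one

theorem measurable_condDistFun {d : ℕ} (κ : Kernel (Fin d → ℝ) ℝ) [IsMarkovKernel κ] (y : ℝ) :
    Measurable fun x => condDistFun κ x y :=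
  (κ.measurable_coe measurableSet_Iic).ennreal_toReal

theorem indicator_one_nonneg {α : Type*} (s : Set α) (a : α) :
    0 ≤ s.indicator (fun _ => (1 : ℝ)) a :=
  Set.indicator_nonneg (fun _ _ => zero_le_one) _

theorem indicator_one_le_one {α : Type*} (s : Set α) (a : α) :
    s.indicator (fun _ => (1 : ℝ)) a ≤ 1 :=
  Set.indicator_le_self' (fun _ _ => zero_le_one) _

/-- The difference between the indicator of `Y ≤ y` and its conditional probability given `X`. -/
noncomputable def indicatorResidual {d : ℕ} (κ : Kernel (Fin d → ℝ) ℝ) (y : ℝ)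
    (e : (Fin d → ℝ) × ℝ) : ℝ :=
  (Set.Iic y).indicator (fun _ => 1) e.2 - condDistFun κ e.1 y

theorem measurable_indicatorResidual {d : ℕ} (κ : Kernel (Fin d → ℝ) ℝ) [IsMarkovKernel κ]
    (y : ℝ) : Measurable (indicatorResidual κ y) :=
  ((measurable_const.indicator measurableSet_Iic).comp measurable_snd).sub
    ((measurable_condDistFun κ y).comp measurable_fst)

theorem abs_indicatorResidual_le_one {d : ℕ} (κ : Kernel (Fin d → ℝ) ℝ) [IsMarkovKernel κ]
    (y : ℝ) (e : (Fin d → ℝ) × ℝ) : |indicatorResidual κ y e| ≤ 1 := by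
  have h1 := indicator_one_nonneg (Set.Iic y) e.2
  have h2 := indicator_one_le_one (Set.Iic y) e.2
  have h3 := condDistFun_nonneg κ e.1 y
  have h4 := condDistFun_le_one κ e.1 y
  rw [indicatorResidual, abs_le]
  constructor <;> linarith

theorem integral_indicator_mul_indicatorResidual {d : ℕ} {P : Measure ((Fin d → ℝ) × ℝ)}
    [IsProbabilityMeasure P] {κ : Kernel (Fin d → ℝ) ℝ} [IsMarkovKernel κ]
    (hκ : P.IsCondKernel κ) (y : ℝ) {B : Set (Fin d → ℝ)} (hB : MeasurableSet B) :
    ∫ e, B.indicator (fun _ => 1) e.1 * indicatorResidual κ y e ∂P = 0 := by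
  have hm : Measurable fun e : (Fin d → ℝ) × ℝ =>
      B.indicator (fun _ => (1 : ℝ)) e.1 * indicatorResidual κ y e :=
    ((measurable_const.indicator hB).comp measurable_fst).mul (measurable_indicatorResidual κ y)
  have hint : Integrable (fun e : (Fin d → ℝ) × ℝ =>
      B.indicator (fun _ => (1 : ℝ)) e.1 * indicatorResidual κ y e) (P.fst ⊗ₘ κ) := by
    refine Integrable.of_mem_Icc (-1) 1 hm.aemeasurable (ae_of_all _ fun e => abs_le.1 ?_)
    rw [abs_mul, abs_of_nonneg (indicator_one_nonneg _ _)]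
    exact mul_le_one₀ (indicator_one_le_one _ _) (abs_nonneg _) (abs_indicatorResidual_le_one κ y e)
  rw [← hκ.disintegrate, Measure.integral_compProd hint]
  refine (integral_congr_ae (ae_of_all _ fun a => ?_)).trans (integral_zero _ _)
  simp only [indicatorResidual]
  rw [integral_const_mul, integral_sub _ (integrable_const _), integral_indicator measurableSet_Iic]
  · simp [condDistFun]
  · exact (integrable_const _).indicator measurableSet_Iic

/-! ### Growth of the leaf sizes -/

theorem summable_one_div_mul_log_rpow {γ : ℝ} (hγ : 1 < γ) :
    Summable fun n : ℕ => 1 / ((n : ℝ) * Real.log n ^ γ) := by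
  have hlog : ∀ n : ℕ, 0 ≤ Real.log ((n : ℝ) + 1) := fun n => by
    exact_mod_cast Real.log_natCast_nonneg (n + 1)
  have hpos : ∀ n : ℕ, 0 < n → 0 < Real.log ((n : ℝ) + 1) := fun n hn =>
    Real.log_pos (by
      have : (0 : ℝ) < n := by exact_mod_cast hn
      linarith)
  -- the shift makes the terms decreasing: the unshifted one of index `1` is the junk value `0`
  have hshift : Summable fun n : ℕ => 1 / (((n : ℝ) + 1) * Real.log ((n : ℝ) + 1) ^ γ) := by
    refine (summable_condensed_iff_of_nonneg (fun n => ?_) fun m n hm hmn => ?_).1 ?_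
    · exact one_div_nonneg.2 (mul_nonneg (by positivity) (Real.rpow_nonneg (hlog n) _))
    · have h1 : (0 : ℝ) < m := by exact_mod_cast hm
      have h2 : (m : ℝ) ≤ n := by exact_mod_cast hmn
      have h3 := hpos m hm
      gcongr
    · refine summable_of_isBigO_nat (Real.summable_one_div_nat_rpow.2 hγ)
        (Asymptotics.IsBigO.of_bound (Real.log 2 ^ γ)⁻¹ ?_)
      filter_upwards [eventually_gt_atTop 0] with k hk
      have hl2 : 0 < Real.log 2 := Real.log_pos one_lt_two
      rw [Real.norm_of_nonneg (mul_nonneg (by positivity) (one_div_nonneg.2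
        (mul_nonneg (by positivity) (Real.rpow_nonneg (hlog _) _)))),
        Real.norm_of_nonneg (one_div_nonneg.2 (Real.rpow_nonneg (Nat.cast_nonneg k) _))]
      have hk' : (0 : ℝ) < k := by exact_mod_cast hk
      have h1 : k * Real.log 2 ≤ Real.log (((2 ^ k : ℕ) : ℝ) + 1) := by
        rw [← Real.log_pow]
        push_cast
        exact Real.log_le_log (by positivity) (by linarith)
      calc (2 : ℝ) ^ k * (1 / ((((2 ^ k : ℕ) : ℝ) + 1) * Real.log (((2 ^ k : ℕ) : ℝ) + 1) ^ γ))
          ≤ 2 ^ k * (1 / (2 ^ k * (k * Real.log 2) ^ γ)) := by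
            gcongr
            push_cast
            linarith
        _ = (Real.log 2 ^ γ)⁻¹ * (1 / (k : ℝ) ^ γ) := by
            rw [Real.mul_rpow hk'.le hl2.le]
            field_simp
  refine (summable_nat_add_iff 1).1 ?_
  simpa using hshift

/-- By Chebyshev's inequality and the Borel–Cantelli lemma, variables whose coefficient of
variation is `O(1 / (√n (log n) ^ (γ / 2)))`, with `1 < γ`, are eventually more than half of
their means. -/
theorem ae_eventually_half_mean_le {Ω : Type*} [MeasurableSpace Ω] {μ : Measure Ω}
    [IsProbabilityMeasure μ] {N : ℕ → Ω → ℝ} (hN : ∀ n, MemLp (N n) 2 μ) {γ : ℝ} (hγ : 1 < γ)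
    (hmean : ∀ᶠ n in atTop, 0 < ∫ ω, N n ω ∂μ)
    (hcv : (fun n => coeffVariation μ (N n)) =O[atTop]
      fun n : ℕ => 1 / (√(n : ℝ) * Real.log n ^ (γ / 2))) :
    ∀ᵐ ω ∂μ, ∀ᶠ n in atTop, (∫ ω, N n ω ∂μ) / 2 ≤ N n ω := by
  set m : ℕ → ℝ := fun n => ∫ ω, N n ω ∂μ with hm
  have hsq : ∀ n, variance (N n) μ / (m n / 2) ^ 2 = 4 * coeffVariation μ (N n) ^ 2 := fun n => by
    rw [coeffVariation, div_pow, div_pow, Real.sq_sqrt (variance_nonneg _ _)]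
    ring
  have hsum : Summable fun n => variance (N n) μ / (m n / 2) ^ 2 := by
    refine summable_of_isBigO_nat (summable_one_div_mul_log_rpow hγ) ?_
    simp only [hsq]
    refine ((hcv.pow 2).const_mul_left 4).congr_right fun n => ?_
    rw [div_pow, mul_pow, Real.sq_sqrt (Nat.cast_nonneg n), one_pow,
      ← Real.rpow_mul_natCast (Real.log_natCast_nonneg n)]
    norm_num
  set bad : ℕ → Set Ω := fun n => {ω | 0 < m n ∧ m n / 2 ≤ |N n ω - m n|} with hbad
  have hbadle : ∀ n, μ (bad n) ≤ ENNReal.ofReal (variance (N n) μ / (m n / 2) ^ 2) := fun n => by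
    by_cases hn : 0 < m n
    · refine le_trans (measure_mono fun ω hω => ?_)
        (meas_ge_le_variance_div_sq (hN n) (half_pos hn))
      exact hω.2
    · simp [hbad, hn]
  filter_upwards [ae_eventually_notMem (ne_top_of_le_ne_top hsum.tsum_ofReal_ne_top
    (ENNReal.tsum_le_tsum hbadle))] with ω hω
  filter_upwards [hω, hmean] with n hn hpos
  simp only [hbad, Set.mem_ofPred_eq, not_and, not_le] at hn
  have := (abs_lt.1 (hn hpos)).1
  change m n / 2 ≤ N n ω
  linarith

theorem tendsto_div_zero_of_sqrt_mul_log_rpow_le {β c : ℝ} (hβ : 1 < β) (hc : 0 < c) (C : ℝ)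
    {a b : ℕ → ℝ} (ha : ∀ᶠ n : ℕ in atTop, c * (√(n : ℝ) * Real.log n ^ β) ≤ a n)
    (hab : ∀ᶠ n : ℕ in atTop, |a n - b n| ≤ √(n : ℝ) * Real.log n) :
    Tendsto (fun n : ℕ => (√(n : ℝ) * Real.log n + C) / b n) atTop (𝓝 0) ∧
      ∀ᶠ n in atTop, 0 < b n := by
  have hlog : Tendsto (fun n : ℕ => Real.log n) atTop atTop :=
    Real.tendsto_log_atTop.comp tendsto_natCast_atTop_atTop
  have hsqrt : Tendsto (fun n : ℕ => √(n : ℝ)) atTop atTop :=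
    Real.tendsto_sqrt_atTop.comp tendsto_natCast_atTop_atTop
  have hr : Tendsto (fun n : ℕ => √(n : ℝ) * Real.log n) atTop atTop := hsqrt.atTop_mul_atTop₀ hlog
  have hpow : Tendsto (fun n : ℕ => Real.log n ^ (β - 1)) atTop atTop :=
    (tendsto_rpow_atTop (sub_pos.2 hβ)).comp hlog
  -- `√n log n + C` is negligible with respect to `√n (log n) ^ β`
  have hsmall : ∀ δ > 0, ∀ᶠ n : ℕ in atTop, 0 < √(n : ℝ) * Real.log n ^ β ∧
      √(n : ℝ) * Real.log n + |C| ≤ δ * (√(n : ℝ) * Real.log n ^ β) := by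
    intro δ hδ
    filter_upwards [hr.eventually_ge_atTop |C|, hr.eventually_gt_atTop 0,
      hlog.eventually_gt_atTop 0, hpow.eventually_ge_atTop (2 / δ)] with n h1 h2 h3 h4
    have h5 : √(n : ℝ) * Real.log n ^ β = (√(n : ℝ) * Real.log n) * Real.log n ^ (β - 1) := by
      rw [Real.rpow_sub_one h3.ne']
      field_simp
    rw [div_le_iff₀ hδ] at h4
    have h6 : 0 < Real.log n ^ (β - 1) := Real.rpow_pos_of_pos h3 _
    rw [h5]
    exact ⟨mul_pos h2 h6, by nlinarith⟩
  have hb : ∀ᶠ n : ℕ in atTop, 0 < √(n : ℝ) * Real.log n ^ β ∧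
      c / 2 * (√(n : ℝ) * Real.log n ^ β) ≤ b n := by
    filter_upwards [ha, hab, hsmall (c / 2) (half_pos hc)] with n h1 h2 h3
    have := (abs_le.1 h2).2
    have := abs_nonneg C
    exact ⟨h3.1, by linarith⟩
  refine ⟨Metric.tendsto_nhds.2 fun ε hε => ?_, ?_⟩
  · filter_upwards [hb, hsmall (ε * c / 4) (by positivity)] with n h1 h2
    have hbpos : 0 < b n := lt_of_lt_of_le (mul_pos (half_pos hc) h1.1) h1.2
    rw [Real.dist_eq, sub_zero, abs_div, abs_of_pos hbpos, div_lt_iff₀ hbpos]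
    have h3 : |√(n : ℝ) * Real.log n + C| ≤ √(n : ℝ) * Real.log n + |C| := by
      refine (abs_add_le _ _).trans_eq ?_
      rw [abs_of_nonneg (mul_nonneg (Real.sqrt_nonneg _) (Real.log_natCast_nonneg n))]
    have h4 : ε * (c / 2 * (√(n : ℝ) * Real.log n ^ β)) ≤ ε * b n :=
      mul_le_mul_of_nonneg_left h1.2 hε.le
    have h5 : 0 < ε * c * (√(n : ℝ) * Real.log n ^ β) := mul_pos (mul_pos hε hc) h1.1
    linarith
  · filter_upwards [hb] with n h
    exact lt_of_lt_of_le (mul_pos (half_pos hc) h.1) h.2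

/-! ### The estimate of a single tree -/

/-- The estimate at `y` of a distribution function by the observations of the sample `S` that fall
into the cell `A`; it is `0` if there is none. -/
noncomputable def cellEstimate {d n : ℕ} (S : Fin n → (Fin d → ℝ) × ℝ) (A : Set (Fin d → ℝ))
    (y : ℝ) : ℝ :=
  (∑ j, A.indicator (fun _ => 1) (S j).1 * (Set.Iic y).indicator (fun _ => 1) (S j).2) /
    (countIn S A : ℝ)

theorem cellEstimate_nonneg {d n : ℕ} (S : Fin n → (Fin d → ℝ) × ℝ) (A : Set (Fin d → ℝ))
    (y : ℝ) : 0 ≤ cellEstimate S A y :=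
  div_nonneg (Finset.sum_nonneg fun _ _ =>
    mul_nonneg (indicator_one_nonneg _ _) (indicator_one_nonneg _ _)) (Nat.cast_nonneg _)

theorem cellEstimate_le_one {d n : ℕ} (S : Fin n → (Fin d → ℝ) × ℝ) (A : Set (Fin d → ℝ))
    (y : ℝ) : cellEstimate S A y ≤ 1 := by
  refine div_le_one_of_le₀ ?_ (Nat.cast_nonneg _)
  rw [countIn_eq_sum_indicator]
  exact Finset.sum_le_sum fun j _ =>
    mul_le_of_le_one_right (indicator_one_nonneg _ _) (indicator_one_le_one _ _)

theorem monotone_cellEstimate {d n : ℕ} (S : Fin n → (Fin d → ℝ) × ℝ) (A : Set (Fin d → ℝ)) :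
    Monotone (cellEstimate S A) := by
  intro y y' hy
  refine div_le_div_of_nonneg_right (Finset.sum_le_sum fun j _ => ?_) (Nat.cast_nonneg _)
  exact mul_le_mul_of_nonneg_left (Set.indicator_le_indicator_of_subset
    (Set.Iic_subset_Iic.2 hy) (fun _ => zero_le_one) _) (indicator_one_nonneg _ _)

/-- Decomposition of the error of the estimate in a cell into a stochastic error and a bias. -/
theorem abs_cellEstimate_sub_le {d n : ℕ} (κ : Kernel (Fin d → ℝ) ℝ)
    (S : Fin n → (Fin d → ℝ) × ℝ) {A : Set (Fin d → ℝ)} (hA : 0 < (countIn S A : ℝ)) (y : ℝ)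
    {F v : ℝ} (hv : ∀ z ∈ A, |condDistFun κ z y - F| ≤ v) :
    |cellEstimate S A y - F| ≤
      |∑ j, A.indicator (fun _ => 1) (S j).1 * indicatorResidual κ y (S j)| / countIn S A + v := by
  have hdecomp : cellEstimate S A y - F =
      (∑ j, A.indicator (fun _ => 1) (S j).1 * indicatorResidual κ y (S j)) / countIn S A +
      (∑ j, A.indicator (fun _ => 1) (S j).1 * (condDistFun κ (S j).1 y - F)) / countIn S A := by
    rw [cellEstimate, ← add_div, ← Finset.sum_add_distrib, sub_eq_iff_eq_add, ← sub_eq_iff_eq_add',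
      ← sub_div, ← Finset.sum_sub_distrib]
    rw [div_eq_iff hA.ne', countIn_eq_sum_indicator, Finset.mul_sum]
    refine Finset.sum_congr rfl fun j _ => ?_
    rw [indicatorResidual]
    ring
  rw [hdecomp]
  refine (abs_add_le _ _).trans ?_
  rw [abs_div, abs_div, abs_of_pos hA]
  gcongr
  rw [div_le_iff₀ hA, countIn_eq_sum_indicator, Finset.mul_sum]
  refine (Finset.abs_sum_le_sum_abs _ _).trans (Finset.sum_le_sum fun j _ => ?_)
  by_cases hj : (S j).1 ∈ A
  · simpa [hj] using hv _ hj
  · simp [hj]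

theorem originalEstimator_eq_average {Ω : Type*} {d : ℕ} (𝒳 : Set (Fin d → ℝ))
    (grow : GrowingRule d) (D : ℕ → Ω → (Fin d → ℝ) × ℝ) (Θ : ℕ → Ω → TreeSeed d) (k : ℕ)
    (x : Fin d → ℝ) (n : ℕ) (ω : Ω) (y : ℝ) :
    originalEstimator 𝒳 grow D Θ k x n ω y =
      (∑ l ∈ Finset.range k,
        cellEstimate (trainingSample D n ω) (treeCell 𝒳 grow D (Θ l) x n ω) y) / k := by
  simp only [originalEstimator, originalWeight, cellEstimate, originalCount]
  simp only [mul_assoc, ← Finset.mul_sum, Finset.sum_mul]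
  rw [Finset.sum_comm, one_div, inv_mul_eq_div]
  congr 1
  refine Finset.sum_congr rfl fun l _ => ?_
  rw [Finset.sum_div]
  refine Finset.sum_congr rfl fun j _ => ?_
  rw [div_mul_eq_mul_div]
  rfl

theorem measurableSet_mem_leafCell {d : ℕ} {𝒳 : Set (Fin d → ℝ)} {minLeaf : ℕ → ℕ}
    {grow : GrowingRule d} (hgrow : IsCARTRule 𝒳 minLeaf grow) {x : Fin d → ℝ} (hx : x ∈ 𝒳)
    (n : ℕ) {w : TreeSeed d × (ℕ → (Fin d → ℝ) × ℝ) → Fin d → ℝ} (hw : Measurable w) :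
    MeasurableSet {z : TreeSeed d × (ℕ → (Fin d → ℝ) × ℝ) |
      w z ∈ leafCell (grow n (z.1 n).2 fun i => z.2 ((z.1 n).1 i)) 𝒳 x} := by
  have hseed : Measurable fun z : TreeSeed d × (ℕ → (Fin d → ℝ) × ℝ) => z.1 n :=
    (measurable_pi_apply n).comp measurable_fst
  have hboot : Measurable fun z : TreeSeed d × (ℕ → (Fin d → ℝ) × ℝ) =>
      (fun i => z.2 ((z.1 n).1 i) : Fin n → (Fin d → ℝ) × ℝ) := by
    have h : Measurable fun q : (Fin n → Fin n) × (ℕ → (Fin d → ℝ) × ℝ) =>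
        (fun i => q.2 (q.1 i) : Fin n → (Fin d → ℝ) × ℝ) :=
      measurable_from_prod_countable_right fun f =>
        measurable_pi_lambda _ fun i => measurable_pi_apply (f i : ℕ)
    exact h.comp (hseed.fst.prodMk measurable_snd)
  exact (hseed.snd.prodMk (hboot.prodMk hw)) (hgrow.measurable_cell n x hx)

theorem measurable_cellEstimate_leafCell {d : ℕ} {𝒳 : Set (Fin d → ℝ)} {minLeaf : ℕ → ℕ}
    {grow : GrowingRule d} (hgrow : IsCARTRule 𝒳 minLeaf grow) {x : Fin d → ℝ} (hx : x ∈ 𝒳)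
    (n : ℕ) (y : ℝ) :
    Measurable fun z : TreeSeed d × (ℕ → (Fin d → ℝ) × ℝ) =>
      cellEstimate (fun j : Fin n => z.2 j)
        (leafCell (grow n (z.1 n).2 fun i => z.2 ((z.1 n).1 i)) 𝒳 x) y := by
  have hobs : ∀ j : ℕ, Measurable fun z : TreeSeed d × (ℕ → (Fin d → ℝ) × ℝ) => z.2 j := fun j =>
    (measurable_pi_apply j).comp measurable_snd
  have hcell : ∀ j : ℕ, Measurable fun z : TreeSeed d × (ℕ → (Fin d → ℝ) × ℝ) =>
      (leafCell (grow n (z.1 n).2 fun i => z.2 ((z.1 n).1 i)) 𝒳 x).indicator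
        (fun _ => (1 : ℝ)) (z.2 j).1 := fun j =>
    (measurable_const (a := (1 : ℝ))).indicator
      (measurableSet_mem_leafCell hgrow hx n (hobs j).fst)
  simp only [cellEstimate, countIn_eq_sum_indicator]
  refine Measurable.div (Finset.measurable_fun_sum _ fun j _ => (hcell j).mul ?_)
    (Finset.measurable_fun_sum _ fun j _ => hcell j)
  exact (measurable_const.indicator measurableSet_Iic).comp (hobs j).snd

theorem measurable_bootstrapCount {Ω : Type*} [MeasurableSpace Ω] {d : ℕ}
    {𝒳 : Set (Fin d → ℝ)} {minLeaf : ℕ → ℕ} {grow : GrowingRule d}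
    (hgrow : IsCARTRule 𝒳 minLeaf grow) {D : ℕ → Ω → (Fin d → ℝ) × ℝ}
    (hD : ∀ j, Measurable (D j)) {θ : Ω → TreeSeed d} (hθ : Measurable θ) {x : Fin d → ℝ}
    (hx : x ∈ 𝒳) (n : ℕ) :
    Measurable fun ω => (bootstrapCount 𝒳 grow D θ x n ω : ℝ) := by
  have hseed : Measurable fun z : TreeSeed d × (ℕ → (Fin d → ℝ) × ℝ) => (z.1 n).1 :=
    measurable_fst.comp ((measurable_pi_apply n).comp measurable_fst)
  have hobs : ∀ i : Fin n, Measurable fun z : TreeSeed d × (ℕ → (Fin d → ℝ) × ℝ) =>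
      (z.2 ((z.1 n).1 i)).1 := fun i => by
    have h : Measurable fun q : (Fin n → Fin n) × (ℕ → (Fin d → ℝ) × ℝ) => (q.2 (q.1 i)).1 :=
      measurable_from_prod_countable_right fun f =>
        measurable_fst.comp (measurable_pi_apply (f i : ℕ))
    exact h.comp (hseed.prodMk measurable_snd)
  have hcount : Measurable fun z : TreeSeed d × (ℕ → (Fin d → ℝ) × ℝ) =>
      ∑ i : Fin n, (leafCell (grow n (z.1 n).2 fun i => z.2 ((z.1 n).1 i)) 𝒳 x).indicator
        (fun _ => (1 : ℝ)) (z.2 ((z.1 n).1 i)).1 :=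
    Finset.measurable_fun_sum _ fun i _ => (measurable_const (a := (1 : ℝ))).indicator
      (measurableSet_mem_leafCell hgrow hx n (hobs i))
  have := hcount.comp (hθ.prodMk (measurable_pi_lambda (fun ω j => D j ω) hD))
  simp only [bootstrapCount, countIn_eq_sum_indicator]
  exact this

/-- Under either assumption on the leaf sizes, the leaf of `x` almost surely has eventually at
least `c √n (log n) ^ β` bootstrap observations, for some `c > 0` and `β > 1`. -/
theorem ae_exists_le_bootstrapCount {Ω : Type*} [MeasurableSpace Ω] {μ : Measure Ω}
    [IsProbabilityMeasure μ] {d : ℕ} {𝒳 : Set (Fin d → ℝ)} {minLeaf : ℕ → ℕ}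
    {grow : GrowingRule d} (hgrow : IsCARTRule 𝒳 minLeaf grow) {D : ℕ → Ω → (Fin d → ℝ) × ℝ}
    (hD : ∀ j, Measurable (D j)) {Θ : ℕ → Ω → TreeSeed d} (hΘ : ∀ l, Measurable (Θ l))
    (hleaf : LeafSizeAlmostSure μ 𝒳 grow D Θ ∨ LeafSizeMoments μ 𝒳 grow D Θ)
    {x : Fin d → ℝ} (hx : x ∈ 𝒳) (l : ℕ) :
    ∃ β : ℝ, 1 < β ∧ ∀ᵐ ω ∂μ, ∃ c > 0, ∀ᶠ n : ℕ in atTop,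
      c * (√(n : ℝ) * Real.log n ^ β) ≤ (bootstrapCount 𝒳 grow D (Θ l) x n ω : ℝ) := by
  have habs : ∀ (n : ℕ) (β : ℝ), |√(n : ℝ) * Real.log n ^ β| = √(n : ℝ) * Real.log n ^ β :=
    fun n β => abs_of_nonneg
      (mul_nonneg (Real.sqrt_nonneg _) (Real.rpow_nonneg (Real.log_natCast_nonneg n) _))
  rcases hleaf with ⟨β, hβ, h⟩ | ⟨⟨β, hβ, hmean⟩, γ, hγ, hcv⟩
  · refine ⟨β, hβ, ?_⟩
    filter_upwards [h l x hx] with ω hω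
    obtain ⟨c, hc, n₀, -, hn⟩ := hω
    refine ⟨c, hc, eventually_atTop.2 ⟨n₀, fun n h => ?_⟩⟩
    have := hn n h
    rwa [habs, abs_of_nonneg (Nat.cast_nonneg _)] at this
  · refine ⟨β, hβ, ?_⟩
    obtain ⟨c, hc, n₀, -, hn⟩ := hmean l x hx
    have hlow : ∀ n ≥ n₀, c * (√(n : ℝ) * Real.log n ^ β) ≤
        ∫ ω, (bootstrapCount 𝒳 grow D (Θ l) x n ω : ℝ) ∂μ := fun n h => by
      have := hn n h
      rwa [habs, abs_of_nonneg (integral_nonneg fun ω => Nat.cast_nonneg _)] at this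
    have hpos : ∀ᶠ n in atTop, 0 < ∫ ω, (bootstrapCount 𝒳 grow D (Θ l) x n ω : ℝ) ∂μ := by
      filter_upwards [eventually_ge_atTop n₀, eventually_gt_atTop 1] with n h1 h2
      have h3 : (1 : ℝ) < n := by exact_mod_cast h2
      refine lt_of_lt_of_le ?_ (hlow n h1)
      have := Real.log_pos h3
      positivity
    have hLp : ∀ n, MemLp (fun ω => (bootstrapCount 𝒳 grow D (Θ l) x n ω : ℝ)) 2 μ := fun n => by
      refine MemLp.of_bound (measurable_bootstrapCount hgrow hD (hΘ l) hx n).aestronglyMeasurable n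
        (ae_of_all _ fun ω => ?_)
      rw [Real.norm_of_nonneg (Nat.cast_nonneg _)]
      exact Nat.cast_le.2 (countIn_le _ _)
    filter_upwards [ae_eventually_half_mean_le hLp hγ hpos (hcv l x hx)] with ω hω
    refine ⟨c / 2, half_pos hc, ?_⟩
    filter_upwards [hω, eventually_ge_atTop n₀] with n h1 h2
    have := hlow n h2
    linarith

/-- The estimate of a single tree is consistent. -/
theorem ae_tendsto_cellEstimate_treeCell {Ω : Type*} [MeasurableSpace Ω] {μ : Measure Ω}
    [IsProbabilityMeasure μ] {d : ℕ} {𝒳 : Set (Fin d → ℝ)} (h𝒳 : MeasurableSet 𝒳)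
    {P : Measure ((Fin d → ℝ) × ℝ)} [IsProbabilityMeasure P]
    {κ : Kernel (Fin d → ℝ) ℝ} [IsMarkovKernel κ] (hκ : P.IsCondKernel κ)
    {D : ℕ → Ω → (Fin d → ℝ) × ℝ} (hD : ∀ j, Measurable (D j)) (hlaw : ∀ j, μ.map (D j) = P)
    (hindep : iIndepFun D μ) {maxFeatures minLeaf : ℕ → ℕ}
    {Θ : ℕ → Ω → TreeSeed d} (hΘ : IsForestSeed μ maxFeatures Θ)
    (hΘD : IndepFun (fun ω l => Θ l ω) (fun ω j => D j ω) μ)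
    {grow : GrowingRule d} (hgrow : IsCARTRule 𝒳 minLeaf grow)
    (hvar : CellVariationVanishes μ 𝒳 κ grow D Θ)
    (hleaf : LeafSizeAlmostSure μ 𝒳 grow D Θ ∨ LeafSizeMoments μ 𝒳 grow D Θ)
    {x : Fin d → ℝ} (hx : x ∈ 𝒳) (y : ℝ) (l : ℕ) :
    ∀ᵐ ω ∂μ, Tendsto (fun n => |cellEstimate (trainingSample D n ω)
      (treeCell 𝒳 grow D (Θ l) x n ω) y - condDistFun κ x y|) atTop (𝓝 0) := by
  obtain ⟨β, hβ, hcount⟩ := ae_exists_le_bootstrapCount hgrow hD hΘ.measurable hleaf hx l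
  have hboot := ae_eventually_abs_countIn_bootstrap_sub_le h𝒳 hD (hΘ.measurable l)
    (hΘD.comp (measurable_pi_apply l) measurable_id) (hΘ.draws_uniform l)
  have hsum := ae_eventually_abs_sum_indicator_mul_le h𝒳 hD hindep hlaw
    (measurable_indicatorResidual κ y) (abs_indicatorResidual_le_one κ y)
    (fun B hB => integral_indicator_mul_indicatorResidual hκ y hB)
  filter_upwards [hcount, hboot, hsum, hvar l x hx y] with ω ⟨c, hc, h1⟩ h2 h3 h4
  have hsub : ∀ n, treeCell 𝒳 grow D (Θ l) x n ω ⊆ 𝒳 := fun n => leafCell_subset _ _ _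
  have hbox : ∀ n, IsBoxTrace 𝒳 (treeCell 𝒳 grow D (Θ l) x n ω) := fun n =>
    IsBoxTrace.leafCell _ (fun u hu _ _ => hu) _
  obtain ⟨h5, h6⟩ := tendsto_div_zero_of_sqrt_mul_log_rpow_le hβ hc (2 * d) h1
    (b := fun n => (originalCount 𝒳 grow D (Θ l) x n ω : ℝ))
    (h2.mono fun n h => h _ (hsub n) (hbox n))
  have hlim := h5.add h4
  rw [add_zero] at hlim
  refine squeeze_zero' (Eventually.of_forall fun n => abs_nonneg _) ?_ hlim
  filter_upwards [h3, h6] with n h7 h8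
  have hbdd : BddAbove (Set.range fun z : treeCell 𝒳 grow D (Θ l) x n ω =>
      |condDistFun κ (z : Fin d → ℝ) y - condDistFun κ x y|) := by
    refine ⟨1, ?_⟩
    rintro _ ⟨z, rfl⟩
    exact abs_sub_le_of_nonneg_of_le (condDistFun_nonneg _ _ _) (condDistFun_le_one _ _ _)
      (condDistFun_nonneg _ _ _) (condDistFun_le_one _ _ _)
  refine (abs_cellEstimate_sub_le κ (trainingSample D n ω) h8 y
    fun z hz => le_ciSup hbdd ⟨z, hz⟩).trans ?_
  exact add_le_add_left (div_le_div_of_nonneg_right (h7 _ (hsub n) (hbox n)) h8.le) _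

/-! ### Consistency of the forest -/

theorem mainTheorem2 {Ω : Type*} [MeasurableSpace Ω] (μ : Measure Ω) [IsProbabilityMeasure μ]
    {d : ℕ} (𝒳 : Set (Fin d → ℝ)) (h𝒳 : MeasurableSet 𝒳)
    -- the law of the prototype pair and a regular conditional law of the response
    (P : Measure ((Fin d → ℝ) × ℝ)) [IsProbabilityMeasure P]
    (hP𝒳 : ∀ᵐ p ∂P, p.1 ∈ 𝒳)
    (κ : Kernel (Fin d → ℝ) ℝ) [IsMarkovKernel κ] (hκ : P.IsCondKernel κ)
    -- the i.i.d. observations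
    (D : ℕ → Ω → (Fin d → ℝ) × ℝ) (hD_meas : ∀ j, Measurable (D j))
    (hD_law : ∀ j, μ.map (D j) = P) (hD_indep : iIndepFun D μ)
    -- the parameters of the forest, and the number of trees
    (maxFeatures minLeaf k : ℕ → ℕ)
    (hmax : ∀ n, 1 ≤ maxFeatures n ∧ maxFeatures n ≤ d)
    (hmin : ∀ n, 1 ≤ n → 1 ≤ minLeaf n ∧ minLeaf n ≤ n)
    (hk : ∀ n, 1 ≤ k n)
    -- the randomization of the trees, independent of the observations
    (Θ : ℕ → Ω → TreeSeed d) (hΘ : IsForestSeed μ maxFeatures Θ)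
    (hΘD : IndepFun (fun ω l => Θ l ω) (fun ω j => D j ω) μ)
    (grow : GrowingRule d) (hgrow : IsCARTRule 𝒳 minLeaf grow)
    -- the three hypotheses
    (hyp1 : CellVariationVanishes μ 𝒳 κ grow D Θ)
    (hyp2_trees : ∃ α : ℝ, 0 < α ∧ (fun n : ℕ => (k n : ℝ)) =O[atTop] fun n : ℕ => (n : ℝ) ^ α)
    (hyp2_leaves : LeafSizeAlmostSure μ 𝒳 grow D Θ ∨ LeafSizeMoments μ 𝒳 grow D Θ)
    (hyp3 : ∀ x ∈ 𝒳, Continuous (condDistFun κ x) ∧ StrictMono (condDistFun κ x)) :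
    ∀ x ∈ 𝒳, ∀ᵐ ω ∂μ,
      Tendsto (fun n : ℕ =>
        ⨆ y : ℝ, |originalEstimator 𝒳 grow D Θ (k n) x n ω y - condDistFun κ x y|)
        atTop (𝓝 0) := by
  intro x hx
  have hkpos : ∀ n, (0 : ℝ) < k n := fun n => by exact_mod_cast hk n
  refine ae_tendsto_iSup_abs_sub_of_monotone
    (F := fun n ω y => originalEstimator 𝒳 grow D Θ (k n) x n ω y) ?_ ?_ ?_
    (hyp3 x hx).2.monotone (hyp3 x hx).1 ?_ ?_ fun y => ?_
  · intro n ω y y' hy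
    simp only [originalEstimator_eq_average]
    gcongr
    exact monotone_cellEstimate _ _ hy
  · intro n ω y
    rw [originalEstimator_eq_average]
    exact div_nonneg (Finset.sum_nonneg fun l _ => cellEstimate_nonneg _ _ _) (hkpos n).le
  · intro n ω y
    rw [originalEstimator_eq_average]
    refine div_le_one_of_le₀ ?_ (hkpos n).le
    simpa using Finset.sum_le_card_nsmul (Finset.range (k n)) _ 1
      fun l _ => cellEstimate_le_one _ _ _
  · rw [condDistFun_eq_cdf]
    exact tendsto_cdf_atBot _
  · rw [condDistFun_eq_cdf]
    exact tendsto_cdf_atTop _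
  · have hDm : Measurable fun ω j => D j ω := measurable_pi_lambda _ hD_meas
    have havg := ae_tendsto_average_zero_of_indepFun hΘ.measurable hΘ.indep hΘ.identDistrib hDm
      hΘD (g := fun n z => |cellEstimate (fun j : Fin n => z.2 j)
        (leafCell (grow n (z.1 n).2 fun i => z.2 ((z.1 n).1 i)) 𝒳 x) y - condDistFun κ x y|)
      (fun n => ((measurable_cellEstimate_leafCell hgrow hx n y).sub_const _).abs)
      (fun n z => abs_nonneg _)
      (fun n z => abs_sub_le_of_nonneg_of_le (cellEstimate_nonneg _ _ _)
        (cellEstimate_le_one _ _ _) (condDistFun_nonneg _ _ _) (condDistFun_le_one _ _ _)) k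
      (fun l => ae_tendsto_cellEstimate_treeCell h𝒳 hκ hD_meas hD_law hD_indep hΘ hΘD hgrow hyp1
        hyp2_leaves hx y l)
    filter_upwards [havg] with ω hω
    rw [tendsto_iff_dist_tendsto_zero]
    refine squeeze_zero (fun n => dist_nonneg) (fun n => ?_) hω
    rw [Real.dist_eq, originalEstimator_eq_average, ← mul_div_cancel_left₀ (condDistFun κ x y)
      (hkpos n).ne', ← sub_div, abs_div, abs_of_pos (hkpos n), mul_div_cancel_left₀ _ (hkpos n).ne']
    refine div_le_div_of_nonneg_right ?_ (hkpos n).le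
    have hconst : (k n : ℝ) * condDistFun κ x y =
        ∑ _l ∈ Finset.range (k n), condDistFun κ x y := by simp
    rw [hconst, ← Finset.sum_sub_distrib]
    exact Finset.abs_sum_le_sum_abs _ _
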